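/- **Setting.** Let $\mathbb I,\mathbb J$ be countable index sets. Let $D,T$ be the unitary operators $[Df](x)=\sqrt2\,f(2x)$, $[Tf](x)=f(x-1)$ on $L^2(\mathbb R)$. Let $\{L_i\}_{i\in\mathbb I}$ be an orthonormal basis of $L^2[0,1)$, let $\{K_{+,j}\}_{j\in\mathbb J}$ and $\{K_{-,j}\}_{j\in\mathbb J}$ be orthonormal bases of $L^2[1,2)$ and $L^2(-2,-1]$, and put $L_i^{(n)}(x)=L_i(x-n)$ and $K_{s,j}^{(m)}(x)=2^{m/2}K_{s,j}(2^mx)$ (extended by $0$), $n,m\in\mathbb Z$. Fix orthonormal bases $\{u_i\}_{i\in\mathbb I}$ of $\ell^2(\mathbb I)$ and $\{w_{s,j}\}_{s=\pm,j\in\mathbb J}$ of $\ell^2(\mathbb J)\oplus\ell^2(\mathbb J)$. Give the unit circle $\partial\mathbb D$ the normalized Lebesgue measure, and let $$\mathcal F:L^2(\mathbb R)\to L^2(\partial\mathbb D;\ell^2(\mathbb I)),\quad [\mathcal Ff](\omega)=\sum_{i}\Big[\sum_{n}\omega^n\langle f,L_i^{(n)}\rangle\Big]u_i,$$ $$\mathcal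 G:L^2(\mathbb R)\to L^2(\partial\mathbb D;\ell^2(\mathbb J)\oplus\ell^2(\mathbb J)),\quad [\mathcal Gf](\omega)=\sum_{s,j}\Big[\sum_{m}\omega^m\langle f,K_{s,j}^{(m)}\rangle\Big]w_{s,j}$$ be the spectral models of $T$ and $D$. Write $\hat{\mathfrak C}$, $\tilde{\mathfrak C}$ for the subspaces of constant functions in the two model spaces, and $\langle\cdot\rangle$ for closed linear span. For a separable Hilbert space $\mathcal H$, a *rigid function* is a weakly measurable map $A:\partial\mathbb D\to\mathcal L(\mathcal H)$ such that, for a.e. $\omega$, $A(\omega)$ is a partial isometry with one and the same initial space; $A\,\mathfrak C$ is the set of functions $\omega\mapsto A(\omega)h$, $h\in\mathcal H$. A *measurable range function* is a map $J$ from $\partial\mathbb D$ to the closed subspaces of $\mathcal H$ whose orthogonal projections are weakly measurable, and $\mathfrak M_J=\{f\in L^2(\partial\mathbb D;\mathcal H): f(\omega)\in J(\omega)\text{ a.e.}\}$. An *orthonormal wavelet* is a $\psi\in L^2(\mathbb R)$ such that $\{D^jT^k\psi:j,k\in\mathbb Z\}$ is an orthonormal basis of $L^2(\mathbb R)$. **Theorem.**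 Consider rigid functions $\hat A$ (on $\ell^2(\mathbb I)$) and $\tilde B,\tilde C$ (on $\ell^2(\mathbb J)\oplus\ell^2(\mathbb J)$) and the conditions (i) the initial spaces of $\hat A$ and $\tilde B$ are one-dimensional, and $\tilde C(\omega)$ is unitary for a.e. $\omega$; (ii) $\mathcal F^{-1}\langle\omega^k\hat A\,\hat{\mathfrak C}:k\in\mathbb Z\rangle=\mathcal G^{-1}\langle\tilde C\,\tilde{\mathfrak C}\rangle$; (iii) $\langle\psi\rangle=\mathcal F^{-1}\langle\hat A\,\hat{\mathfrak C}\rangle=\mathcal G^{-1}\langle\tilde B\,\tilde{\mathfrak C}\rangle$; (iii') $\mathcal F^{-1}\langle\hat A\,\hat{\mathfrak C}\rangle=\mathcal G^{-1}\langle\tilde B\,\tilde{\mathfrak C}\rangle$. 1. If $\psi$ is an orthonormal wavelet, then there is a triple $(\hat A,\tilde B,\tilde C)$ of rigid functions satisfying (i), (ii), (iii). It is unique up to constant partially isometric factors on the right: if $(\hat A',\tilde B',\tilde C')$ is another such triple for $\psi$, then $\hat A'(\omega)=\hat A(\omega)U$ for a.e. $\omega$, with $U$ a constant partial isometry whose initial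 space is that of $\hat A'$ and whose range is the initial space of $\hat A$; and likewise for $\tilde B,\tilde B'$ and $\tilde C,\tilde C'$. 2. Conversely, let $(\hat A,\tilde B,\tilde C)$ be a triple of rigid functions satisfying (i), (ii), (iii'). For every unit vector $u$ in the initial space of $\hat A$ there are a unique $\psi\in L^2(\mathbb R)$ with $[\mathcal F\psi](\omega)=\hat A(\omega)u$ a.e., and a unique unit vector $v$ in the initial space of $\tilde B$ such that $\psi$ is also the unique function with $[\mathcal G\psi](\omega)=\tilde B(\omega)v$ a.e., i.e. $\psi=\mathcal F^{-1}[\hat Au]=\mathcal G^{-1}[\tilde Bv]$. This $\psi$ is an orthonormal wavelet satisfying (iii), and every orthonormal wavelet satisfying (iii) for the same triple is $c\,\psi$ for some $c\in\mathbb C$ with $|c|=1$. 3. For every triple of rigid functions satisfying (i), (ii), (iii') there is a measurable range function $\hat J$ on $\partial\mathbb D$ with values in the closed subspaces of $\ell^2(\mathbb I)$, one-dimensional for a.e. $\omega$, such that $$\mathcal F^{-1}\mathfrak M_{\hat J}=\mathcal F^{-1}\langle\omega^k\hat A\,\hat{\mathfrak C}:k\in\mathbb Z\rangle=\mathcal G^{-1}\langle\tilde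 C\,\tilde{\mathfrak C}\rangle,$$ and this subspace equals $\langle T^k\psi:k\in\mathbb Z\rangle$ for every $\psi\in L^2(\mathbb R)$ satisfying (iii). -/

import Mathlib

open MeasureTheory Set
open scoped ENNReal ComplexConjugate

noncomputable section

namespace WaveletModel

/-! ### `L²` of the line, dyadic dilations, integer translations, wavelets -/

/-- The Hilbert space `L²(ℝ)`. -/
abbrev L2R : Type := Lp ℂ 2 (volume : Measure ℝ)

theorem memLp_dilate (m : ℤ) (f : L2R) :
    MemLp (fun x : ℝ => (((2 : ℝ) ^ ((m : ℝ) / 2) : ℝ) : ℂ) * f ((2 : ℝ) ^ m * x)) 2 volume := by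
  have h2 : ((2 : ℝ) ^ m) ≠ 0 := zpow_ne_zero _ two_ne_zero
  refine MemLp.const_mul ?_ _
  have hf : MemLp (f : ℝ → ℂ) 2 (Measure.map ((2 : ℝ) ^ m * ·) volume) := by
    rw [Real.map_volume_mul_left h2]
    exact (Lp.memLp f).smul_measure ENNReal.ofReal_ne_top
  exact hf.comp_of_map (measurable_const_mul _).aemeasurable

/-- `D ^ m` for the unitary dilation `(D f)(x) = √2 f(2x)`: `(D ^ m f)(x) = 2 ^ (m/2) f(2 ^ m x)`. -/
def dilate (m : ℤ) (f : L2R) : L2R := (memLp_dilate m f).toLp _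

/-- `T ^ k` for the unitary translation `(T f)(x) = f(x - 1)`: `(T ^ k f)(x) = f(x - k)`. -/
def translate (k : ℤ) (f : L2R) : L2R :=
  Lp.compMeasurePreserving (fun x : ℝ => x - (k : ℝ)) (measurePreserving_sub_right volume (k : ℝ)) f

/-- The closed linear span `⟨S⟩`, as a set. -/
def closedSpan {E : Type*} [NormedAddCommGroup E] [InnerProductSpace ℂ E] (S : Set E) : Set E :=
  ((Submodule.span ℂ S).topologicalClosure : Set E)

/-- `ψ` is an orthonormal wavelet: the functions `D ^ j T ^ k ψ`, `j, k ∈ ℤ`, form an orthonormal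
basis of `L²(ℝ)`. -/
def IsOrthonormalWavelet (ψ : L2R) : Prop :=
  Orthonormal ℂ (fun p : ℤ × ℤ => dilate p.1 (translate p.2 ψ)) ∧
    closedSpan (Set.range fun p : ℤ × ℤ => dilate p.1 (translate p.2 ψ)) = Set.univ

/-! ### The unit circle and vector-valued `L²` spaces on it -/

instance instMeasurableSpaceCircle : MeasurableSpace Circle := borel Circle

instance instBorelSpaceCircle : BorelSpace Circle := ⟨rfl⟩

/-- Normalized arc length `dω / 2π` on the unit circle. -/
def circleMeasure : Measure Circle :=
  Measure.map (AddCircle.toCircle (T := (1 : ℝ))) AddCircle.haarAddCircle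

instance instIsProbabilityMeasureCircle : IsProbabilityMeasure circleMeasure :=
  Measure.isProbabilityMeasure_map AddCircle.continuous_toCircle.measurable.aemeasurable

section VectorValued

variable {H : Type*} [NormedAddCommGroup H] [InnerProductSpace ℂ H]

/-- The Hilbert space `L²(∂𝔻; H)`. -/
abbrev L2T (H : Type*) [NormedAddCommGroup H] : Type _ := Lp H 2 circleMeasure

/-- The element `ω ↦ ω ^ n • h` of `L²(∂𝔻; H)`. -/
def monomial (n : ℤ) (h : H) : L2T H :=
  ContinuousMap.toLp 2 circleMeasure ℂ
    (⟨fun ω : Circle => ((ω ^ n : Circle) : ℂ) • h,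
      Continuous.smul (Continuous.comp (by fun_prop) (continuous_zpow n)) continuous_const⟩ : C(Circle, H))

/-- `A : ∂𝔻 → L(H)` is weakly measurable: all scalar functions `(A(ω) h, g)` are Borel. -/
def WeaklyMeasurable (A : Circle → H →L[ℂ] H) : Prop :=
  ∀ h g : H, Measurable fun ω => (inner ℂ g (A ω h) : ℂ)

/-- `B` is a partial isometry with initial space the closed subspace `N`. -/
structure IsPartialIsometryWith (B : H →L[ℂ] H) (N : Submodule ℂ H) : Prop where
  isClosed : IsClosed (N : Set H)
  norm_map : ∀ u ∈ N, ‖B u‖ = ‖u‖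
  map_orthogonal : ∀ v ∈ Nᗮ, B v = 0

/-- `A` is a rigid operator function whose (almost everywhere constant) initial space is `N`. -/
structure IsRigidWith (A : Circle → H →L[ℂ] H) (N : Submodule ℂ H) : Prop where
  weaklyMeasurable : WeaklyMeasurable A
  isPartialIsometry : ∀ᵐ ω ∂circleMeasure, IsPartialIsometryWith (A ω) N

/-- `A` is a rigid operator function. -/
def IsRigid (A : Circle → H →L[ℂ] H) : Prop := ∃ N : Submodule ℂ H, IsRigidWith A N

/-- The image `A 𝔠` of the space `𝔠` of constant functions. -/
def constImage (A : Circle → H →L[ℂ] H) : Set (L2T H) :=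
  {f | ∃ h : H, f =ᵐ[circleMeasure] fun ω => A ω h}

/-- The union over `k ∈ ℤ` of the sets `ω ^ k A 𝔠`. -/
def shiftedConstImage (A : Circle → H →L[ℂ] H) : Set (L2T H) :=
  {f | ∃ (k : ℤ) (h : H), f =ᵐ[circleMeasure] fun ω => (ω : ℂ) ^ k • A ω h}

/-- The rigid functions `A` and `A'` are equal up to a constant partially isometric factor on the
right: `A'(ω) = A(ω) U` a.e., where `U` is a partial isometry from the initial space of `A'` onto
the initial space of `A`. -/
def EqUpToRightFactor (A A' : Circle → H →L[ℂ] H) : Prop :=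
  ∃ (N N' : Submodule ℂ H) (U : H →L[ℂ] H),
    IsRigidWith A N ∧ IsRigidWith A' N' ∧ IsPartialIsometryWith U N' ∧
      U '' (N' : Set H) = (N : Set H) ∧ ∀ᵐ ω ∂circleMeasure, A' ω = A ω ∘L U

/-- The range function `J` is measurable: the orthogonal projection `P(ω)` onto `J(ω)` is weakly
measurable. -/
def IsMeasurableRange [CompleteSpace H] (J : Circle → ClosedSubmodule ℂ H) : Prop :=
  WeaklyMeasurable fun ω => (J ω).toSubmodule.starProjection

/-- The space `𝔐_J` of all `f ∈ L²(∂𝔻; H)` with `f(ω) ∈ J(ω)` for a.e. `ω`. -/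
def rangeSpace (J : Circle → ClosedSubmodule ℂ H) : Set (L2T H) :=
  {f | ∀ᵐ ω ∂circleMeasure, f ω ∈ J ω}

end VectorValued

/-! ### The spectral models of translation and dilation -/

/-- `ℓ²(I)`. -/
abbrev Seq (I : Type*) : Type _ := lp (fun _ : I => ℂ) 2

/-- The Hilbert space direct sum `ℓ²(J) ⊕ ℓ²(J)`. -/
abbrev SeqPair (J : Type*) : Type _ := WithLp 2 (Seq J × Seq J)

/-- The half-open interval `[1, 2)` for `s = 1`, and `(-2, -1]` for `s = -1`. -/
def cell (s : ℤˣ) : Set ℝ := {x | ((s : ℤ) : ℝ) * x ∈ Ico (1 : ℝ) 2}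

/-- The coefficient of `f` with respect to `x ↦ L_i(x - n)` on `[n, n + 1)`. -/
def transCoeff {I : Type*} (L : HilbertBasis I ℂ (Lp ℂ 2 (volume.restrict (Ico (0 : ℝ) 1))))
    (f : L2R) (i : I) (n : ℤ) : ℂ :=
  ∫ x in Ico (n : ℝ) (n + 1), f x * conj (L i (x - n))

/-- The coefficient of `f` with respect to `x ↦ 2 ^ (m/2) K_{s,j}(2 ^ m x)` on the dilated interval
`2 ^ (-m) • cell s`. -/
def dilCoeff {J : Type*} (K : ∀ s : ℤˣ, HilbertBasis J ℂ (Lp ℂ 2 (volume.restrict (cell s))))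
    (f : L2R) (s : ℤˣ) (j : J) (m : ℤ) : ℂ :=
  ∫ x in {x : ℝ | (2 : ℝ) ^ m * x ∈ cell s},
    f x * conj ((((2 : ℝ) ^ ((m : ℝ) / 2) : ℝ) : ℂ) * K s j ((2 : ℝ) ^ m * x))

/-- The spectral model `𝓕 : L²(ℝ) → L²(∂𝔻; ℓ²(I))` of the translation `T`:
`𝓕 f = ⊕_i [∑_n ω ^ n f_i^(n)] u_i`. The coefficients are square summable and the functions
`ω ^ n u_i` are orthonormal, so the (unconditional) series converges in `L²(∂𝔻; ℓ²(I))`. -/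
def transModel {I : Type*} (L : HilbertBasis I ℂ (Lp ℂ 2 (volume.restrict (Ico (0 : ℝ) 1))))
    (u : HilbertBasis I ℂ (Seq I)) (f : L2R) : L2T (Seq I) :=
  ∑' p : I × ℤ, transCoeff L f p.1 p.2 • monomial p.2 (u p.1)

/-- The spectral model `𝓖 : L²(ℝ) → L²(∂𝔻; ℓ²(J) ⊕ ℓ²(J))` of the dilation `D`:
`𝓖 f = ⊕_{s,j} [∑_m ω ^ m f_{s,j}^(m)] w_{s,j}`. -/
def dilModel {J : Type*} (K : ∀ s : ℤˣ, HilbertBasis J ℂ (Lp ℂ 2 (volume.restrict (cell s))))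
    (w : HilbertBasis (ℤˣ × J) ℂ (SeqPair J)) (f : L2R) : L2T (SeqPair J) :=
  ∑' p : (ℤˣ × J) × ℤ, dilCoeff K f p.1.1 p.1.2 p.2 • monomial p.2 (w p.1)

/-! ### Conditions on a triple of operator functions

`F` and `G` stand for the two spectral models. -/

section Conditions

variable {H₁ H₂ : Type*} [NormedAddCommGroup H₁] [InnerProductSpace ℂ H₁]
  [NormedAddCommGroup H₂] [InnerProductSpace ℂ H₂]

/-- `A`, `B`, `C` are rigid; `A` and `B` have the one-dimensional initial spaces `NA` and `NB`;
`C(ω)` is unitary for a.e. `ω`. -/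
structure CondRigid [CompleteSpace H₂] (A : Circle → H₁ →L[ℂ] H₁) (NA : Submodule ℂ H₁)
    (B : Circle → H₂ →L[ℂ] H₂) (NB : Submodule ℂ H₂) (C : Circle → H₂ →L[ℂ] H₂) : Prop where
  rigid_A : IsRigidWith A NA
  rigid_B : IsRigidWith B NB
  rigid_C : IsRigid C
  finrank_A : Module.finrank ℂ NA = 1
  finrank_B : Module.finrank ℂ NB = 1
  unitary_C : ∀ᵐ ω ∂circleMeasure, C ω ∈ unitary (H₂ →L[ℂ] H₂)

/-- `F⁻¹⟨ω ^ k A 𝔠 : k ∈ ℤ⟩ = G⁻¹⟨C 𝔠⟩`. -/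
def CondCompat (F : L2R → L2T H₁) (G : L2R → L2T H₂) (A : Circle → H₁ →L[ℂ] H₁)
    (C : Circle → H₂ →L[ℂ] H₂) : Prop :=
  F ⁻¹' closedSpan (shiftedConstImage A) = G ⁻¹' closedSpan (constImage C)

/-- `⟨ψ⟩ = F⁻¹⟨A 𝔠⟩ = G⁻¹⟨B 𝔠⟩`. -/
def CondLine (F : L2R → L2T H₁) (G : L2R → L2T H₂) (ψ : L2R) (A : Circle → H₁ →L[ℂ] H₁)
    (B : Circle → H₂ →L[ℂ] H₂) : Prop :=
  closedSpan {ψ} = F ⁻¹' closedSpan (constImage A) ∧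
    closedSpan {ψ} = G ⁻¹' closedSpan (constImage B)

end Conditions

end WaveletModel

end

/-!
The coefficients in the two spectral models are inner products against Hilbert bases of `L²(ℝ)`,
obtained by translating (respectively dilating) bases of a fundamental domain whose copies tile the
line. The models carry these bases to the bases `ω ^ n b_i` of `L²(∂𝔻; H)`, so both are unitary,
and they turn `T` and `D` into multiplication by `ω`
(`exists_transModel_isometryEquiv`, `exists_dilModel_isometryEquiv`).

The mechanism behind everything else is uniqueness of Fourier coefficients for integrable
functions: if `ω ^ n f ⟂ g` for all `n ≠ 0`, then `⟪f(ω), g(ω)⟫` is constant almost everywhere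
(`ae_inner_eq_of_inner_shift_eq_zero`), and conversely. Orthogonality under the shift is thus a
fibrewise statement.

From a wavelet `ψ` to a triple: the translates of `ψ` are orthonormal, so `𝓕 ψ` has pointwise norm
one and spans `⟨A 𝔠⟩` for a rigid `A` of rank one; in the same way `𝓖 ψ` gives `B`. The span of
the translates is a complete wandering subspace for `D`, so the fields `𝓖 (T ^ k ψ)` form a Hilbert
basis of almost every fibre, and carrying the basis at one good point to the basis at `ω` defines a
unitary `C(ω)` (`exists_unitary_of_basis_field`).

Uniqueness: for a rigid `A` with initial space `N`, the map sending `h ∈ N` to the field `A h` is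
an isometry onto `⟨A 𝔠⟩`. Two rigid functions with the same `⟨A 𝔠⟩` hence differ by a constant
partial isometry (`eqUpToRightFactor_of_closedSpan_eq`).

From a triple to a wavelet: `ψ = 𝓕⁻¹ (A x)` has orthonormal translates because `A x` has pointwise
norm one, and their span is `𝓖⁻¹ (C 𝔠)`. Since `C` is unitary-valued, the shifts of `C 𝔠` are
mutually orthogonal and complete, which is the wavelet property
(`isOrthonormalWavelet_of_unitary`). The range function is `J(ω) = ℂ A(ω) x`: a field orthogonal
to all `ω ^ k A x` is fibrewise orthogonal to `A x` (`rangeSpace_eq_closedSpan_shift`).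
-/

noncomputable section

namespace WaveletModel

/-! ### Fourier analysis on the circle -/

theorem fourier_eq_toCircle_zpow (n : ℤ) (x : AddCircle (1 : ℝ)) :
    fourier n x = ((AddCircle.toCircle x : Circle) : ℂ) ^ n := by
  rw [fourier_apply, AddCircle.toCircle_zsmul, Circle.coe_zpow]

theorem norm_coe_zpow (ω : Circle) (n : ℤ) : ‖(ω : ℂ) ^ n‖ = 1 := by
  rw [norm_zpow, Circle.norm_coe, one_zpow]

theorem continuous_coe_zpow (n : ℤ) : Continuous fun ω : Circle => (ω : ℂ) ^ n := by
  simp_rw [← Circle.coe_zpow]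
  exact continuous_subtype_val.comp (continuous_zpow n)

theorem conj_coe_zpow (ω : Circle) (n : ℤ) : conj ((ω : ℂ) ^ n) = (ω : ℂ) ^ (-n) := by
  rw [map_zpow₀, ← Circle.coe_inv_eq_conj, Circle.coe_inv, inv_zpow, zpow_neg]

theorem integral_circleMeasure {E : Type*} [NormedAddCommGroup E] [NormedSpace ℝ E]
    {g : Circle → E} (hg : AEStronglyMeasurable g circleMeasure) :
    ∫ ω, g ω ∂circleMeasure = ∫ x : AddCircle (1 : ℝ), g (AddCircle.toCircle x)
      ∂AddCircle.haarAddCircle :=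
  integral_map AddCircle.continuous_toCircle.measurable.aemeasurable hg

theorem integral_coe_zpow (n : ℤ) :
    ∫ ω : Circle, (ω : ℂ) ^ n ∂circleMeasure = if n = 0 then 1 else 0 := by
  rw [integral_circleMeasure (continuous_coe_zpow n).aestronglyMeasurable]
  simp_rw [← fourier_eq_toCircle_zpow]
  have h := orthonormal_iff_ite.1 (orthonormal_fourier (T := (1 : ℝ))) 0 n
  rw [fourierLp, ContinuousMap.inner_toLp] at h
  simpa [eq_comm] using h

/-- Uniqueness of Fourier coefficients: an integrable function on the circle all of whose Fourier
coefficients vanish is zero almost everywhere. -/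
theorem ae_eq_zero_of_forall_integral_zpow_mul {g : Circle → ℂ} (hg : Integrable g circleMeasure)
    (h : ∀ n : ℤ, ∫ ω : Circle, (ω : ℂ) ^ n * g ω ∂circleMeasure = 0) :
    ∀ᵐ ω ∂circleMeasure, g ω = 0 := by
  have hmp : MeasurePreserving (AddCircle.toCircle (T := (1 : ℝ))) AddCircle.haarAddCircle
      circleMeasure := ⟨AddCircle.continuous_toCircle.measurable, rfl⟩
  set g' : AddCircle (1 : ℝ) → ℂ := fun x => g (AddCircle.toCircle x)
  have hg' : Integrable g' AddCircle.haarAddCircle := hmp.integrable_comp_of_integrable hg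
  -- the functional `φ ↦ ∫ φ g` is continuous for the uniform norm
  let Λ : C(AddCircle (1 : ℝ), ℂ) →L[ℂ] ℂ :=
    LinearMap.mkContinuous
      { toFun := fun φ => ∫ x, φ x * g' x ∂AddCircle.haarAddCircle
        map_add' := fun φ χ => by
          simp only [ContinuousMap.add_apply, add_mul]
          exact integral_add (hg'.bdd_mul (c := ‖φ‖) φ.continuous.aestronglyMeasurable
            (.of_forall φ.norm_coe_le_norm)) (hg'.bdd_mul (c := ‖χ‖)
              χ.continuous.aestronglyMeasurable (.of_forall χ.norm_coe_le_norm))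
        map_smul' := fun c φ => by
          simp only [ContinuousMap.smul_apply, smul_eq_mul, mul_assoc, RingHom.id_apply]
          exact integral_const_mul _ _ }
      (∫ x, ‖g' x‖ ∂AddCircle.haarAddCircle) fun φ => by
        refine (norm_integral_le_integral_norm _).trans ?_
        rw [mul_comm, ← integral_const_mul]
        refine integral_mono_of_nonneg (.of_forall fun x => norm_nonneg _)
          (hg'.norm.const_mul _) (.of_forall fun x => ?_)
        simp only [norm_mul]
        gcongr
        exact φ.norm_coe_le_norm x
  -- it vanishes on the monomials, whose span is uniformly dense
  have hΛ : ∀ φ, Λ φ = 0 := by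
    intro φ
    have hker : (Submodule.span ℂ (Set.range <| @fourier (1 : ℝ))).topologicalClosure
        ≤ LinearMap.ker (Λ : C(AddCircle (1 : ℝ), ℂ) →ₗ[ℂ] ℂ) := by
      refine Submodule.topologicalClosure_minimal _ (Submodule.span_le.2 ?_) Λ.isClosed_ker
      rintro _ ⟨n, rfl⟩
      have := h n
      rw [integral_circleMeasure (g := fun ω : Circle => (ω : ℂ) ^ n * g ω)
        ((continuous_coe_zpow n).aestronglyMeasurable.mul hg.aestronglyMeasurable)] at this
      simp_rw [← fourier_eq_toCircle_zpow] at this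
      exact this
    rw [span_fourier_closure_eq_top] at hker
    exact hker (Submodule.mem_top (x := φ))
  -- on the manifold `Circle` it suffices to test `g` against smooth functions
  refine ae_eq_zero_of_integral_contMDiff_smul_eq_zero (modelWithCornersSelf ℝ
    (EuclideanSpace ℝ (Fin 1))) hg.locallyIntegrable fun φ hφ _ => ?_
  rw [integral_circleMeasure (g := fun ω => φ ω • g ω)
    (hφ.continuous.aestronglyMeasurable.smul hg.aestronglyMeasurable)]
  have := hΛ ⟨fun x => ((φ (AddCircle.toCircle x) : ℝ) : ℂ),
    Complex.continuous_ofReal.comp (hφ.continuous.comp AddCircle.continuous_toCircle)⟩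
  simpa [Λ, Complex.real_smul, g'] using this

/-! ### The shift on vector-valued functions -/

section Shift

variable {H : Type*} [NormedAddCommGroup H] [InnerProductSpace ℂ H]

theorem memLp_zpow_smul (n : ℤ) (f : L2T H) :
    MemLp (fun ω : Circle => (ω : ℂ) ^ n • f ω) 2 circleMeasure :=
  (Lp.memLp f).of_le ((continuous_coe_zpow n).aestronglyMeasurable.smul
    (Lp.aestronglyMeasurable f)) (.of_forall fun ω => by
      rw [norm_smul, norm_coe_zpow, one_mul])

/-- Multiplication by `ω ^ n` on `L²(∂𝔻; H)`. -/
def shift (n : ℤ) : L2T H →ₗᵢ[ℂ] L2T H where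
  toFun f := (memLp_zpow_smul n f).toLp _
  map_add' f g := by
    ext1
    filter_upwards [(memLp_zpow_smul n (f + g)).coeFn_toLp, (memLp_zpow_smul n f).coeFn_toLp,
      (memLp_zpow_smul n g).coeFn_toLp, Lp.coeFn_add f g, Lp.coeFn_add
      ((memLp_zpow_smul n f).toLp _) ((memLp_zpow_smul n g).toLp _)] with ω h1 h2 h3 h4 h5
    rw [h1, h5, Pi.add_apply, h2, h3, h4, Pi.add_apply, smul_add]
  map_smul' c f := by
    ext1
    filter_upwards [(memLp_zpow_smul n (c • f)).coeFn_toLp, (memLp_zpow_smul n f).coeFn_toLp,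
      Lp.coeFn_smul c f, Lp.coeFn_smul c ((memLp_zpow_smul n f).toLp _)] with ω h1 h2 h3 h4
    rw [h1, RingHom.id_apply, h4, Pi.smul_apply, h2, h3, Pi.smul_apply, smul_comm]
  norm_map' f := by
    simp only [LinearMap.coe_mk, AddHom.coe_mk]
    rw [Lp.norm_toLp, Lp.norm_def]
    congr 1
    refine eLpNorm_congr_norm_ae (.of_forall fun ω => ?_)
    rw [norm_smul, norm_coe_zpow, one_mul]

theorem coeFn_shift (n : ℤ) (f : L2T H) :
    shift n f =ᵐ[circleMeasure] fun ω => (ω : ℂ) ^ n • f ω :=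
  (memLp_zpow_smul n f).coeFn_toLp

theorem shift_shift (m n : ℤ) (f : L2T H) : shift m (shift n f) = shift (m + n) f := by
  ext1
  filter_upwards [coeFn_shift m (shift n f), coeFn_shift n f, coeFn_shift (m + n) f]
    with ω h1 h2 h3
  rw [h1, h2, h3, smul_smul, zpow_add₀ (Circle.coe_ne_zero ω)]

theorem shift_zero (f : L2T H) : shift 0 f = f := by
  ext1
  filter_upwards [coeFn_shift 0 f] with ω h1
  rw [h1, zpow_zero, one_smul]

theorem inner_shift_left (n : ℤ) (f g : L2T H) :
    inner ℂ (shift n f) g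
      = ∫ ω : Circle, (ω : ℂ) ^ (-n) * inner ℂ (f ω) (g ω) ∂circleMeasure := by
  rw [L2.inner_def]
  refine integral_congr_ae ?_
  filter_upwards [coeFn_shift n f] with ω h1
  rw [h1, inner_smul_left, conj_coe_zpow]

/-- If `ω ^ n f ⟂ g` for all `n ≠ 0`, the pointwise inner product of `f` and `g` is constant. -/
theorem ae_inner_eq_of_inner_shift_eq_zero {f g : L2T H}
    (h : ∀ n : ℤ, n ≠ 0 → inner ℂ (shift n f) g = 0) :
    ∀ᵐ ω ∂circleMeasure, inner ℂ (f ω) (g ω) = inner ℂ f g := by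
  have hint : Integrable (fun ω => inner ℂ (f ω) (g ω)) circleMeasure := L2.integrable_inner f g
  -- subtracting the constant also makes the zeroth Fourier coefficient vanish
  have := ae_eq_zero_of_forall_integral_zpow_mul
    (g := fun ω => inner ℂ (f ω) (g ω) - inner ℂ f g) (hint.sub (integrable_const _)) fun n => by
      have h1 : Integrable (fun ω : Circle => (ω : ℂ) ^ n * inner ℂ (f ω) (g ω)) circleMeasure :=
        hint.bdd_mul (c := 1) (continuous_coe_zpow n).aestronglyMeasurable
          (.of_forall fun ω => (norm_coe_zpow ω n).le)
      have h2 : Integrable (fun ω : Circle => (ω : ℂ) ^ n * inner ℂ f g) circleMeasure :=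
        (integrable_const (inner ℂ f g)).bdd_mul (c := 1)
          (continuous_coe_zpow n).aestronglyMeasurable
          (.of_forall fun ω => (norm_coe_zpow ω n).le)
      simp_rw [mul_sub]
      rw [integral_sub h1 h2, integral_mul_const, integral_coe_zpow]
      have h3 := inner_shift_left (-n) f g
      rw [neg_neg] at h3
      rw [← h3]
      split_ifs with hn
      · subst hn; rw [neg_zero, shift_zero]; simp
      · rw [h _ (neg_ne_zero.2 hn)]; simp
  filter_upwards [this] with ω hω using sub_eq_zero.1 hω

theorem ae_inner_eq_zero {f g : L2T H} (h : ∀ n : ℤ, inner ℂ (shift n f) g = 0) :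
    ∀ᵐ ω ∂circleMeasure, inner ℂ (f ω) (g ω) = 0 := by
  have h0 := h 0
  rw [shift_zero] at h0
  simpa only [h0] using ae_inner_eq_of_inner_shift_eq_zero fun n _ => h n

theorem inner_shift_shift (m n : ℤ) (f g : L2T H) :
    inner ℂ (shift m f) (shift n g) = inner ℂ (shift (m - n) f) g := by
  rw [← LinearIsometry.inner_map_map (shift n) (shift (m - n) f) g, shift_shift]
  congr 3; ring

theorem inner_shift_of_ae_inner_eq {f g : L2T H} {c : ℂ}
    (h : ∀ᵐ ω ∂circleMeasure, inner ℂ (f ω) (g ω) = c) (m n : ℤ) :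
    inner ℂ (shift m f) (shift n g) = if m = n then c else 0 := by
  rw [inner_shift_shift, inner_shift_left]
  have : ∫ ω : Circle, (ω : ℂ) ^ (-(m - n)) * inner ℂ (f ω) (g ω) ∂circleMeasure
      = ∫ ω : Circle, (ω : ℂ) ^ (-(m - n)) * c ∂circleMeasure :=
    integral_congr_ae (by filter_upwards [h] with ω hω; rw [hω])
  rw [this, integral_mul_const, integral_coe_zpow]
  simp only [neg_eq_zero, sub_eq_zero]
  split_ifs <;> simp

/-- Fibrewise membership passes to closed linear spans, since `L²` convergence implies almost
everywhere convergence along a subsequence. -/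
theorem ae_mem_of_mem_closedSpan {S : Set (L2T H)} {V : Circle → Submodule ℂ H}
    (hV : ∀ ω, IsClosed (V ω : Set H)) (hS : ∀ f ∈ S, ∀ᵐ ω ∂circleMeasure, f ω ∈ V ω)
    {f : L2T H} (hf : f ∈ closedSpan S) : ∀ᵐ ω ∂circleMeasure, f ω ∈ V ω := by
  have hspan : ∀ g ∈ Submodule.span ℂ S, ∀ᵐ ω ∂circleMeasure, g ω ∈ V ω := by
    intro g hg
    induction hg using Submodule.span_induction with
    | mem g hg => exact hS g hg
    | zero =>
      filter_upwards [Lp.coeFn_zero H 2 circleMeasure] with ω h1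
      rw [h1]; exact (V ω).zero_mem
    | add g k _ _ hg hk =>
      filter_upwards [hg, hk, Lp.coeFn_add g k] with ω h1 h2 h3
      rw [h3]; exact (V ω).add_mem h1 h2
    | smul c g _ hg =>
      filter_upwards [hg, Lp.coeFn_smul c g] with ω h1 h3
      rw [h3]; exact (V ω).smul_mem c h1
  obtain ⟨x, hx, hxf⟩ := mem_closure_iff_seq_limit.1 hf
  obtain ⟨φ, -, hφ⟩ := (tendstoInMeasure_of_tendsto_Lp hxf).exists_seq_tendsto_ae
  have hall : ∀ᵐ ω ∂circleMeasure, ∀ n, x n ω ∈ V ω := ae_all_iff.2 fun n => hspan _ (hx n)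
  filter_upwards [hφ, hall] with ω h1 h2
  exact (hV ω).mem_of_tendsto h1 (.of_forall fun n => h2 _)

theorem coeFn_monomial (n : ℤ) (h : H) :
    monomial n h =ᵐ[circleMeasure] fun ω => (ω : ℂ) ^ n • h := by
  filter_upwards [ContinuousMap.coeFn_toLp (𝕜 := ℂ) (p := 2) circleMeasure
    (⟨fun ω : Circle => ((ω ^ n : Circle) : ℂ) • h,
      Continuous.smul (Continuous.comp (by fun_prop) (continuous_zpow n)) continuous_const⟩ :
      C(Circle, H))] with ω h1
  rw [monomial, h1]
  simp

theorem shift_monomial (m n : ℤ) (h : H) : shift m (monomial n h) = monomial (m + n) h := by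
  ext1
  filter_upwards [coeFn_shift m (monomial n h), coeFn_monomial n h, coeFn_monomial (m + n) h]
    with ω h1 h2 h3
  rw [h1, h2, h3, smul_smul, zpow_add₀ (Circle.coe_ne_zero ω)]

theorem _root_.HilbertBasis.eq_zero_of_forall_inner {ι E : Type*} [NormedAddCommGroup E]
    [InnerProductSpace ℂ E] (b : HilbertBasis ι ℂ E) {x : E} (h : ∀ i, inner ℂ (b i) x = 0) :
    x = 0 := by
  have := b.hasSum_repr x
  simp only [b.repr_apply_apply, h, zero_smul] at this
  exact this.unique hasSum_zero

/-- If the vectors `b i` form a Hilbert basis of `H`, the functions `ω ^ n b i` form a Hilbert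
basis of `L²(∂𝔻; H)`. -/
def monomialBasis [CompleteSpace H] {ι : Type*} [Countable ι] (b : HilbertBasis ι ℂ H) :
    HilbertBasis (ι × ℤ) ℂ (L2T H) :=
  HilbertBasis.mkOfOrthogonalEqBot (v := fun p : ι × ℤ => monomial p.2 (b p.1))
    (by
      classical
      rw [orthonormal_iff_ite]
      rintro ⟨i, m⟩ ⟨j, n⟩
      have h : ∀ᵐ ω ∂circleMeasure, inner ℂ (monomial 0 (b i) ω) (monomial 0 (b j) ω)
          = if i = j then (1 : ℂ) else 0 := by
        filter_upwards [coeFn_monomial 0 (b i), coeFn_monomial 0 (b j)] with ω h1 h2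
        rw [h1, h2, zpow_zero, one_smul, one_smul, orthonormal_iff_ite.1 b.orthonormal]
      have h2 := inner_shift_of_ae_inner_eq h m n
      rw [shift_monomial, shift_monomial, add_zero, add_zero] at h2
      simp only [h2, Prod.mk.injEq]
      by_cases h3 : i = j <;> by_cases h4 : m = n <;> simp [h3, h4])
    (by
      rw [Submodule.eq_bot_iff]
      intro f hf
      have h0 : ∀ᵐ ω ∂circleMeasure, ∀ i, inner ℂ (b i) (f ω) = 0 := by
        refine ae_all_iff.2 fun i => ?_
        have := ae_inner_eq_zero (f := monomial 0 (b i)) (g := f) fun n => by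
          rw [shift_monomial, add_zero]
          exact (Submodule.mem_orthogonal _ _).1 hf _ (Submodule.subset_span ⟨(i, n), rfl⟩)
        filter_upwards [this, coeFn_monomial 0 (b i)] with ω h1 h2
        rwa [h2, zpow_zero, one_smul] at h1
      ext1
      filter_upwards [h0, Lp.coeFn_zero H 2 circleMeasure] with ω h1 h2
      rw [h2]; exact b.eq_zero_of_forall_inner h1)

theorem monomialBasis_apply [CompleteSpace H] {ι : Type*} [Countable ι] (b : HilbertBasis ι ℂ H)
    (p : ι × ℤ) : monomialBasis b p = monomial p.2 (b p.1) := by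
  simp [monomialBasis]

end Shift

/-! ### Hilbert bases of the line generated by a wandering family -/

/-- Translation by `k` as a linear isometry of `L²(ℝ)`. -/
def translateIso (k : ℤ) : L2R →ₗᵢ[ℂ] L2R :=
  Lp.compMeasurePreservingₗᵢ ℂ (fun x : ℝ => x - (k : ℝ))
    (measurePreserving_sub_right volume (k : ℝ))

theorem translateIso_apply (k : ℤ) (f : L2R) : translateIso k f = translate k f := rfl

theorem coeFn_translate (k : ℤ) (f : L2R) :
    translate k f =ᵐ[volume] fun x => f (x - (k : ℝ)) :=
  Lp.coeFn_compMeasurePreserving f (measurePreserving_sub_right volume (k : ℝ))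

theorem coeFn_dilate (m : ℤ) (f : L2R) :
    dilate m f =ᵐ[volume]
      fun x => (((2 : ℝ) ^ ((m : ℝ) / 2) : ℝ) : ℂ) * f ((2 : ℝ) ^ m * x) :=
  (memLp_dilate m f).coeFn_toLp

theorem quasiMeasurePreserving_mul_left {a : ℝ} (ha : a ≠ 0) :
    Measure.QuasiMeasurePreserving (fun x : ℝ => a * x) volume volume := by
  refine ⟨measurable_const_mul a, ?_⟩
  rw [Real.map_volume_mul_left ha]
  exact Measure.smul_absolutelyContinuous

theorem two_rpow_half_mul_self (m : ℤ) :
    (2 : ℝ) ^ ((m : ℝ) / 2) * (2 : ℝ) ^ ((m : ℝ) / 2) = (2 : ℝ) ^ m := by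
  rw [← Real.rpow_add two_pos, add_halves, Real.rpow_intCast]

theorem inner_dilate_self (m : ℤ) (f : L2R) :
    inner ℂ (dilate m f) (dilate m f) = inner ℂ f f := by
  rw [L2.inner_def, L2.inner_def]
  have h : ∫ x, inner ℂ (dilate m f x) (dilate m f x)
      = ∫ x, (((2 : ℝ) ^ m : ℝ) : ℂ) *
        (fun y => inner ℂ (f y) (f y)) ((2 : ℝ) ^ m * x) := by
    refine integral_congr_ae ?_
    filter_upwards [coeFn_dilate m f] with x hx
    rw [hx, ← two_rpow_half_mul_self]
    simp only [RCLike.inner_apply, map_mul, Complex.conj_ofReal, Complex.ofReal_mul]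
    ring
  rw [h, integral_const_mul,
    Measure.integral_comp_mul_left (fun y => (inner ℂ (f y) (f y) : ℂ)) ((2 : ℝ) ^ m)]
  have h2 : (0 : ℝ) < 2 ^ m := zpow_pos two_pos m
  rw [abs_of_pos (inv_pos.2 h2), Complex.real_smul, ← mul_assoc, ← Complex.ofReal_mul,
    mul_inv_cancel₀ h2.ne', Complex.ofReal_one, one_mul]

/-- The power `D ^ m` of the dilation as a linear isometry of `L²(ℝ)`. -/
def dilateIso (m : ℤ) : L2R →ₗᵢ[ℂ] L2R where
  toFun := dilate m
  map_add' f g := by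
    ext1
    filter_upwards [coeFn_dilate m (f + g), coeFn_dilate m f, coeFn_dilate m g,
      (quasiMeasurePreserving_mul_left (zpow_ne_zero m (two_ne_zero' ℝ))).ae (Lp.coeFn_add f g),
      Lp.coeFn_add (dilate m f) (dilate m g)] with x h1 h2 h3 h4 h5
    rw [h1, h5, Pi.add_apply, h2, h3, h4, Pi.add_apply, mul_add]
  map_smul' c f := by
    ext1
    filter_upwards [coeFn_dilate m (c • f), coeFn_dilate m f,
      (quasiMeasurePreserving_mul_left (zpow_ne_zero m (two_ne_zero' ℝ))).ae (Lp.coeFn_smul c f),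
      Lp.coeFn_smul c (dilate m f)] with x h1 h2 h4 h5
    rw [h1, RingHom.id_apply, h5, Pi.smul_apply, h2, h4, Pi.smul_apply, smul_eq_mul, smul_eq_mul,
      mul_left_comm]
  norm_map' f := by
    rw [norm_eq_sqrt_re_inner (𝕜 := ℂ), norm_eq_sqrt_re_inner (𝕜 := ℂ)]
    exact congrArg (fun z : ℂ => √(RCLike.re z)) (inner_dilate_self m f)

theorem dilateIso_apply (m : ℤ) (f : L2R) : dilateIso m f = dilate m f := rfl

theorem translate_translate (m n : ℤ) (f : L2R) :
    translate m (translate n f) = translate (m + n) f := by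
  ext1
  filter_upwards [coeFn_translate m (translate n f),
    (measurePreserving_sub_right volume (m : ℝ)).quasiMeasurePreserving.ae (coeFn_translate n f),
    coeFn_translate (m + n) f] with x h1 h2 h3
  rw [h1, h2, h3]
  push_cast
  congr 1
  ring

theorem translate_zero (f : L2R) : translate 0 f = f := by
  ext1
  filter_upwards [coeFn_translate 0 f] with x h1
  rw [h1]; simp

theorem dilate_dilate (m n : ℤ) (f : L2R) : dilate m (dilate n f) = dilate (m + n) f := by
  ext1
  filter_upwards [coeFn_dilate m (dilate n f),
    (quasiMeasurePreserving_mul_left (zpow_ne_zero m (two_ne_zero' ℝ))).ae (coeFn_dilate n f),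
    coeFn_dilate (m + n) f] with x h1 h2 h3
  rw [h1, h2, h3, ← mul_assoc, ← mul_assoc, ← Complex.ofReal_mul, ← Real.rpow_add two_pos,
    zpow_add₀ two_ne_zero, mul_comm ((2 : ℝ) ^ n)]
  push_cast
  congr 4
  ring

theorem dilate_zero (f : L2R) : dilate 0 f = f := by
  ext1
  filter_upwards [coeFn_dilate 0 f] with x h1
  rw [h1]; simp

/-- Let `V n` be a group of weighted composition operators `f ↦ c n • f ∘ φ n` on `L²(ℝ)` such
that the preimages of `E` under the maps `φ n` tile the line. If `b` is orthonormal, supported in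
`E`, and complete on `E`, then the functions `V n (b i)` form a Hilbert basis of `L²(ℝ)`. -/
theorem exists_hilbertBasis_of_tiling {ι : Type*} {V : ℤ → L2R →ₗᵢ[ℂ] L2R}
    {φ : ℤ → ℝ → ℝ} {c : ℤ → ℂ}
    (hV_add : ∀ m n f, V m (V n f) = V (m + n) f) (hV_zero : ∀ f, V 0 f = f)
    (hV : ∀ n f, V n f =ᵐ[volume] fun x => c n * f (φ n x))
    (hφ : ∀ n, Measure.QuasiMeasurePreserving (φ n) volume volume)
    {E : Set ℝ} (hdisj : ∀ x m n, φ m x ∈ E → φ n x ∈ E → m = n)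
    (hcover : ∀ᵐ x, ∃ n, φ n x ∈ E)
    {b : ι → L2R} (hb : Orthonormal ℂ b) (hsupp : ∀ i, ∀ᵐ x, x ∉ E → b i x = 0)
    (htotal : ∀ f : L2R, (∀ i, inner ℂ (b i) f = 0) → ∀ᵐ x, x ∈ E → f x = 0) :
    ∃ B : HilbertBasis (ι × ℤ) ℂ L2R, ∀ p, B p = V p.2 (b p.1) := by
  classical
  have horth : Orthonormal ℂ fun p : ι × ℤ => V p.2 (b p.1) := by
    rw [orthonormal_iff_ite]
    rintro ⟨i, m⟩ ⟨j, n⟩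
    by_cases hmn : m = n
    · subst hmn
      simp only [LinearIsometry.inner_map_map, Prod.mk.injEq, and_true]
      exact orthonormal_iff_ite.1 hb i j
    · rw [if_neg (by simp [hmn]), L2.inner_def, integral_eq_zero_of_ae]
      filter_upwards [hV m (b i), hV n (b j), (hφ m).ae (hsupp i), (hφ n).ae (hsupp j)]
        with x h1 h2 h3 h4
      rw [h1, h2]
      by_cases hx : φ m x ∈ E
      · rw [h4 fun hx' => hmn (hdisj x m n hx hx')]; simp
      · rw [h3 hx]; simp
  have hbot : (Submodule.span ℂ (Set.range fun p : ι × ℤ => V p.2 (b p.1)))ᗮ = ⊥ := by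
    rw [Submodule.eq_bot_iff]
    intro f hf
    have hzero : ∀ n, ∀ᵐ x, φ n x ∈ E → f x = 0 := by
      intro n
      have h1 : ∀ᵐ x, x ∈ E → V (-n) f x = 0 := by
        refine htotal _ fun i => ?_
        rw [← LinearIsometry.inner_map_map (V n), hV_add, add_neg_cancel, hV_zero]
        exact (Submodule.mem_orthogonal _ _).1 hf _ (Submodule.subset_span ⟨(i, n), rfl⟩)
      have h2 := hV n (V (-n) f)
      rw [hV_add, add_neg_cancel, hV_zero] at h2
      filter_upwards [h2, (hφ n).ae h1] with x h3 h4 h5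
      rw [h3, h4 h5, mul_zero]
    ext1
    filter_upwards [ae_all_iff.2 hzero, hcover, Lp.coeFn_zero ℂ 2 (volume : Measure ℝ)]
      with x h1 ⟨n, hn⟩ h3
    rw [h1 n hn, h3]; rfl
  exact ⟨HilbertBasis.mkOfOrthogonalEqBot horth hbot, fun p => by simp⟩

theorem memLp_indicator {E : Set ℝ} (hE : MeasurableSet E) (g : Lp ℂ 2 (volume.restrict E)) :
    MemLp (E.indicator g) 2 (volume : Measure ℝ) :=
  (memLp_indicator_iff_restrict hE).2 (Lp.memLp g)

/-- Extension by zero from `L²(E)` to `L²(ℝ)`. -/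
def extendZero {E : Set ℝ} (hE : MeasurableSet E) (g : Lp ℂ 2 (volume.restrict E)) : L2R :=
  (memLp_indicator hE g).toLp _

theorem coeFn_extendZero {E : Set ℝ} (hE : MeasurableSet E) (g : Lp ℂ 2 (volume.restrict E)) :
    extendZero hE g =ᵐ[volume] E.indicator g :=
  (memLp_indicator hE g).coeFn_toLp

theorem inner_extendZero_left {E : Set ℝ} (hE : MeasurableSet E)
    (g : Lp ℂ 2 (volume.restrict E)) (f : L2R) :
    inner ℂ (extendZero hE g) f
      = inner ℂ g (((Lp.memLp f).restrict E).toLp f : Lp ℂ 2 (volume.restrict E)) := by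
  rw [L2.inner_def, L2.inner_def]
  trans ∫ x in E, inner ℂ (g x) (f x)
  · rw [← integral_indicator hE]
    refine integral_congr_ae ?_
    filter_upwards [coeFn_extendZero hE g] with x hx
    rw [hx]
    by_cases h : x ∈ E <;> simp [h]
  · refine integral_congr_ae ?_
    filter_upwards [((Lp.memLp f).restrict E).coeFn_toLp] with x hx
    rw [hx]

theorem toLp_restrict_extendZero {E : Set ℝ} (hE : MeasurableSet E)
    (g : Lp ℂ 2 (volume.restrict E)) :
    (((Lp.memLp (extendZero hE g)).restrict E).toLp _ : Lp ℂ 2 (volume.restrict E)) = g := by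
  ext1
  filter_upwards [((Lp.memLp (extendZero hE g)).restrict E).coeFn_toLp,
    ae_restrict_of_ae (coeFn_extendZero hE g), ae_restrict_mem hE] with x h1 h2 h3
  rw [h1, h2, indicator_of_mem h3]

theorem inner_extendZero_extendZero {E : Set ℝ} (hE : MeasurableSet E)
    (g k : Lp ℂ 2 (volume.restrict E)) :
    inner ℂ (extendZero hE g) (extendZero hE k) = inner ℂ g k := by
  rw [inner_extendZero_left, toLp_restrict_extendZero]

theorem ae_eq_zero_of_inner_extendZero {ι : Type*} {E : Set ℝ} (hE : MeasurableSet E)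
    (e : HilbertBasis ι ℂ (Lp ℂ 2 (volume.restrict E))) {f : L2R}
    (h : ∀ i, inner ℂ (extendZero hE (e i)) f = 0) : ∀ᵐ x, x ∈ E → f x = 0 := by
  have h0 := e.eq_zero_of_forall_inner fun i => (inner_extendZero_left hE (e i) f).symm.trans (h i)
  rw [← ae_restrict_iff' hE]
  have h1 := ((Lp.memLp f).restrict E).coeFn_toLp
  rw [h0] at h1
  filter_upwards [h1, Lp.coeFn_zero ℂ 2 (volume.restrict E)] with x h2 h3
  rw [← h2, h3]; rfl

theorem extendZero_apply_of_notMem {E : Set ℝ} (hE : MeasurableSet E)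
    (g : Lp ℂ 2 (volume.restrict E)) : ∀ᵐ x, x ∉ E → extendZero hE g x = 0 := by
  filter_upwards [coeFn_extendZero hE g] with x h1 h2
  rw [h1, indicator_of_notMem h2]

/-! ### The spectral models are unitary -/

section Transfer

variable {ι E₁ E₂ : Type*} [NormedAddCommGroup E₁] [InnerProductSpace ℂ E₁]
  [NormedAddCommGroup E₂] [InnerProductSpace ℂ E₂]

/-- The unitary operator carrying the Hilbert basis `b₁` to the Hilbert basis `b₂`. -/
def basisTransfer (b₁ : HilbertBasis ι ℂ E₁) (b₂ : HilbertBasis ι ℂ E₂) : E₁ ≃ₗᵢ[ℂ] E₂ :=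
  b₁.repr.trans b₂.repr.symm

theorem basisTransfer_eq_tsum (b₁ : HilbertBasis ι ℂ E₁) (b₂ : HilbertBasis ι ℂ E₂) (f : E₁) :
    basisTransfer b₁ b₂ f = ∑' p, (inner ℂ (b₁ p) f : ℂ) • b₂ p := by
  have h := (b₂.hasSum_repr_symm (b₁.repr f)).tsum_eq
  simp only [b₁.repr_apply_apply] at h
  exact h.symm

theorem basisTransfer_apply_basis (b₁ : HilbertBasis ι ℂ E₁) (b₂ : HilbertBasis ι ℂ E₂) (p : ι) :
    basisTransfer b₁ b₂ (b₁ p) = b₂ p := by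
  rw [basisTransfer, LinearIsometryEquiv.trans_apply, LinearIsometryEquiv.symm_apply_eq]
  classical
  rw [b₁.repr_self, b₂.repr_self]

/-- It is enough to check an intertwining relation on the basis vectors. -/
theorem basisTransfer_intertwines {b₁ : HilbertBasis ι ℂ E₁} {b₂ : HilbertBasis ι ℂ E₂}
    {P : E₁ →ₗᵢ[ℂ] E₁} {Q : E₂ →ₗᵢ[ℂ] E₂}
    (h : ∀ p, basisTransfer b₁ b₂ (P (b₁ p)) = Q (b₂ p)) (f : E₁) :
    basisTransfer b₁ b₂ (P f) = Q (basisTransfer b₁ b₂ f) := by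
  have := ContinuousLinearMap.ext_on (f := ((basisTransfer b₁ b₂).toLinearIsometry.comp
      P).toContinuousLinearMap) (g := (Q.comp
      (basisTransfer b₁ b₂).toLinearIsometry).toContinuousLinearMap)
    (Submodule.dense_iff_topologicalClosure_eq_top.2 b₁.dense_span) (by
      rintro _ ⟨p, rfl⟩
      simpa [basisTransfer_apply_basis] using h p)
  exact DFunLike.congr_fun this f

end Transfer

/-- The translates of a Hilbert basis of `L²[0, 1)` form a Hilbert basis of `L²(ℝ)`, since the
intervals `[n, n + 1)` tile the line. -/
theorem exists_transBasis {I : Type*}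
    (L : HilbertBasis I ℂ (Lp ℂ 2 (volume.restrict (Ico (0 : ℝ) 1)))) :
    ∃ B : HilbertBasis (I × ℤ) ℂ L2R,
      ∀ p, B p = translate p.2 (extendZero measurableSet_Ico (L p.1)) := by
  refine exists_hilbertBasis_of_tiling (V := translateIso) (φ := fun n x => x - (n : ℝ))
    (c := fun _ => 1) (E := Ico 0 1) (fun m n f => translate_translate m n f)
    (fun f => translate_zero f) (fun n f => ?_)
    (fun n => (measurePreserving_sub_right volume (n : ℝ)).quasiMeasurePreserving) ?_ ?_ ?_
    (fun i => extendZero_apply_of_notMem _ _)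
    (fun f => ae_eq_zero_of_inner_extendZero _ L)
  · filter_upwards [coeFn_translate n f] with x hx
    rw [one_mul, translateIso_apply, hx]
  · rintro x m n ⟨h1, h2⟩ ⟨h3, h4⟩
    have h5 : (m : ℝ) < n + 1 := by linarith
    have h6 : (n : ℝ) < m + 1 := by linarith
    norm_cast at h5 h6
    omega
  · refine .of_forall fun x => ⟨⌊x⌋, ?_, ?_⟩
    · linarith [Int.floor_le x]
    · linarith [Int.lt_floor_add_one x]
  · classical
    rw [orthonormal_iff_ite]
    intro i j
    rw [inner_extendZero_extendZero, orthonormal_iff_ite.1 L.orthonormal]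

theorem inner_transBasis {I : Type*}
    (L : HilbertBasis I ℂ (Lp ℂ 2 (volume.restrict (Ico (0 : ℝ) 1)))) (f : L2R) (i : I) (n : ℤ) :
    inner ℂ (translate n (extendZero measurableSet_Ico (L i))) f = transCoeff L f i n := by
  rw [L2.inner_def, transCoeff, ← integral_indicator measurableSet_Ico]
  refine integral_congr_ae ?_
  filter_upwards [coeFn_translate n (extendZero measurableSet_Ico (L i)),
    (measurePreserving_sub_right volume (n : ℝ)).quasiMeasurePreserving.ae
      (coeFn_extendZero measurableSet_Ico (L i))] with x h1 h2
  rw [h1, h2]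
  have : x - (n : ℝ) ∈ Ico (0 : ℝ) 1 ↔ x ∈ Ico (n : ℝ) (n + 1) := by
    simp only [mem_Ico]
    constructor <;> rintro ⟨h3, h4⟩ <;> constructor <;> linarith
  by_cases h : x ∈ Ico (n : ℝ) (n + 1)
  · rw [indicator_of_mem h, indicator_of_mem (this.2 h), RCLike.inner_apply]
  · rw [indicator_of_notMem h, indicator_of_notMem (mt this.1 h), inner_zero_left]

/-- The spectral model of translation is unitary and turns translation into the shift. -/
theorem exists_transModel_isometryEquiv {I : Type*} [Countable I]
    (L : HilbertBasis I ℂ (Lp ℂ 2 (volume.restrict (Ico (0 : ℝ) 1))))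
    (u : HilbertBasis I ℂ (Seq I)) :
    ∃ F : L2R ≃ₗᵢ[ℂ] L2T (Seq I), transModel L u = F ∧
      ∀ k f, F (translate k f) = shift k (F f) := by
  obtain ⟨B, hB⟩ := exists_transBasis L
  refine ⟨basisTransfer B (monomialBasis u), ?_, fun k f => ?_⟩
  · funext f
    rw [basisTransfer_eq_tsum, transModel]
    refine tsum_congr fun p => ?_
    rw [hB, inner_transBasis, monomialBasis_apply]
  · refine basisTransfer_intertwines (b₂ := monomialBasis u) (P := translateIso k)
      (Q := shift k) (fun p => ?_) f
    rw [hB, translateIso_apply, translate_translate, monomialBasis_apply, shift_monomial]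
    have := basisTransfer_apply_basis B (monomialBasis u) (p.1, k + p.2)
    rwa [hB, monomialBasis_apply] at this

theorem measurableSet_cell (s : ℤˣ) : MeasurableSet (cell s) :=
  (measurable_const_mul _) measurableSet_Ico

theorem disjoint_cell {s t : ℤˣ} {x : ℝ} (hs : x ∈ cell s) (ht : x ∈ cell t) : s = t := by
  simp only [cell, mem_ofPred_eq, mem_Ico] at hs ht
  rcases Int.units_eq_one_or s with rfl | rfl <;> rcases Int.units_eq_one_or t with rfl | rfl
  all_goals first | rfl | (exfalso; push_cast at hs ht; linarith [hs.1, ht.1])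

/-- The dilates of Hilbert bases of `L²[1, 2)` and `L²(-2, -1]` form a Hilbert basis of `L²(ℝ)`,
since the dyadic dilates of `{x | 1 ≤ |x| < 2}` tile the line without `0`. -/
theorem exists_dilBasis {J : Type*}
    (K : ∀ s : ℤˣ, HilbertBasis J ℂ (Lp ℂ 2 (volume.restrict (cell s)))) :
    ∃ B : HilbertBasis ((ℤˣ × J) × ℤ) ℂ L2R,
      ∀ p, B p = dilate p.2 (extendZero (measurableSet_cell p.1.1) (K p.1.1 p.1.2)) := by
  refine exists_hilbertBasis_of_tiling (V := dilateIso) (φ := fun n x => (2 : ℝ) ^ n * x)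
    (c := fun m => (((2 : ℝ) ^ ((m : ℝ) / 2) : ℝ) : ℂ)) (E := ⋃ s, cell s)
    (b := fun q : ℤˣ × J => extendZero (measurableSet_cell q.1) (K q.1 q.2))
    (fun m n f => dilate_dilate m n f)
    (fun f => dilate_zero f) (fun n f => coeFn_dilate n f)
    (fun n => quasiMeasurePreserving_mul_left (zpow_ne_zero n (two_ne_zero' ℝ))) ?_ ?_ ?_ ?_ ?_
  · have habs : ∀ y : ℝ, y ∈ ⋃ s, cell s → 1 ≤ |y| ∧ |y| < 2 := by
      intro y hy
      obtain ⟨s, hs⟩ := mem_iUnion.1 hy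
      simp only [cell, mem_ofPred_eq, mem_Ico] at hs
      have h1 : |((s : ℤ) : ℝ) * y| = |y| := by
        rcases Int.units_eq_one_or s with rfl | rfl <;> simp
      rw [← h1, abs_of_pos (by linarith [hs.1])]
      exact hs
    intro x m n hm hn
    have hm := habs _ hm
    have hn := habs _ hn
    rw [abs_mul, abs_of_pos (zpow_pos two_pos _)] at hm hn
    have key : ∀ m n : ℤ, m < n → 1 ≤ (2 : ℝ) ^ m * |x| → (2 : ℝ) ^ n * |x| < 2 → False := by
      intro m n hmn h1 h2
      have h3 : (2 : ℝ) ^ (m + 1) ≤ 2 ^ n := zpow_le_zpow_right₀ one_le_two hmn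
      rw [zpow_add_one₀ two_ne_zero] at h3
      nlinarith [abs_nonneg x]
    rcases lt_trichotomy m n with h | h | h
    · exact (key m n h hm.1 hn.2).elim
    · exact h
    · exact (key n m h hn.1 hm.2).elim
  · filter_upwards [Measure.ae_ne volume (0 : ℝ)] with x hx
    obtain ⟨n, hn⟩ := exists_mem_Ico_zpow (abs_pos.2 hx) one_lt_two
    refine ⟨-n, ?_⟩
    have h2 : (0 : ℝ) < 2 ^ n := zpow_pos two_pos n
    have h3 : 1 ≤ (2 : ℝ) ^ (-n) * |x| ∧ (2 : ℝ) ^ (-n) * |x| < 2 := by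
      rw [mem_Ico, zpow_add_one₀ two_ne_zero] at hn
      rw [zpow_neg, inv_mul_eq_div, le_div_iff₀ h2, div_lt_iff₀ h2]
      constructor <;> linarith [hn.1, hn.2]
    rw [mem_iUnion]
    rcases le_or_gt 0 x with h | h
    · refine ⟨1, ?_⟩
      rw [abs_of_nonneg h] at h3
      simpa [cell] using h3
    · refine ⟨-1, ?_⟩
      rw [abs_of_neg h] at h3
      simpa [cell] using h3
  · classical
    rw [orthonormal_iff_ite]
    rintro ⟨s, i⟩ ⟨t, j⟩
    by_cases hst : s = t
    · subst hst
      simp only [Prod.mk.injEq, true_and]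
      rw [inner_extendZero_extendZero, orthonormal_iff_ite.1 (K s).orthonormal]
    · rw [if_neg (by simp [hst]), L2.inner_def, integral_eq_zero_of_ae]
      filter_upwards [extendZero_apply_of_notMem (measurableSet_cell s) (K s i),
        extendZero_apply_of_notMem (measurableSet_cell t) (K t j)] with x h1 h2
      by_cases hx : x ∈ cell s
      · rw [h2 fun hx' => hst (disjoint_cell hx hx')]; simp
      · rw [h1 hx]; simp
  · rintro ⟨s, i⟩
    filter_upwards [extendZero_apply_of_notMem (measurableSet_cell s) (K s i)] with x h1 h2
    exact h1 fun h => h2 (mem_iUnion.2 ⟨s, h⟩)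
  · intro f hf
    have : ∀ s, ∀ᵐ x, x ∈ cell s → f x = 0 := fun s =>
      ae_eq_zero_of_inner_extendZero (measurableSet_cell s) (K s) fun i => hf (s, i)
    filter_upwards [ae_all_iff.2 this] with x h1 h2
    obtain ⟨s, hs⟩ := mem_iUnion.1 h2
    exact h1 s hs

theorem inner_dilBasis {J : Type*}
    (K : ∀ s : ℤˣ, HilbertBasis J ℂ (Lp ℂ 2 (volume.restrict (cell s))))
    (f : L2R) (s : ℤˣ) (j : J) (m : ℤ) :
    inner ℂ (dilate m (extendZero (measurableSet_cell s) (K s j))) f = dilCoeff K f s j m := by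
  have hm : MeasurableSet {x : ℝ | (2 : ℝ) ^ m * x ∈ cell s} :=
    (measurable_const_mul _) (measurableSet_cell s)
  rw [L2.inner_def, dilCoeff, ← integral_indicator hm]
  refine integral_congr_ae ?_
  filter_upwards [coeFn_dilate m (extendZero (measurableSet_cell s) (K s j)),
    (quasiMeasurePreserving_mul_left (zpow_ne_zero m (two_ne_zero' ℝ))).ae
      (coeFn_extendZero (measurableSet_cell s) (K s j))] with x h1 h2
  rw [h1, h2]
  by_cases h : (2 : ℝ) ^ m * x ∈ cell s
  · rw [indicator_of_mem h, indicator_of_mem (by exact h), RCLike.inner_apply]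
  · rw [indicator_of_notMem h, indicator_of_notMem (by exact h), mul_zero, inner_zero_left]

/-- The spectral model of dilation is unitary and turns dilation into the shift. -/
theorem exists_dilModel_isometryEquiv {J : Type*} [Countable J]
    (K : ∀ s : ℤˣ, HilbertBasis J ℂ (Lp ℂ 2 (volume.restrict (cell s))))
    (w : HilbertBasis (ℤˣ × J) ℂ (SeqPair J)) :
    ∃ G : L2R ≃ₗᵢ[ℂ] L2T (SeqPair J), dilModel K w = G ∧
      ∀ k f, G (dilate k f) = shift k (G f) := by
  obtain ⟨B, hB⟩ := exists_dilBasis K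
  refine ⟨basisTransfer B (monomialBasis w), ?_, fun k f => ?_⟩
  · funext f
    rw [basisTransfer_eq_tsum, dilModel]
    refine tsum_congr fun p => ?_
    rw [hB, inner_dilBasis, monomialBasis_apply]
  · refine basisTransfer_intertwines (b₂ := monomialBasis w) (P := dilateIso k)
      (Q := shift k) (fun p => ?_) f
    rw [hB, dilateIso_apply, dilate_dilate, monomialBasis_apply, shift_monomial]
    have := basisTransfer_apply_basis B (monomialBasis w) (p.1, k + p.2)
    rwa [hB, monomialBasis_apply] at this

/-! ### Closed linear spans -/

section ClosedSpan

variable {E E' : Type*} [NormedAddCommGroup E] [InnerProductSpace ℂ E]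
  [NormedAddCommGroup E'] [InnerProductSpace ℂ E']

theorem subset_closedSpan (S : Set E) : S ⊆ closedSpan S :=
  Submodule.subset_span.trans (Submodule.span ℂ S).le_topologicalClosure

theorem closedSpan_subset {S T : Set E} (h : S ⊆ closedSpan T) : closedSpan S ⊆ closedSpan T :=
  Submodule.topologicalClosure_minimal _ (Submodule.span_le.2 h)
    (Submodule.isClosed_topologicalClosure _)

theorem map_mem_closedSpan (P : E →L[ℂ] E') {S : Set E} {T : Set E'}
    (h : ∀ s ∈ S, P s ∈ closedSpan T) {f : E} (hf : f ∈ closedSpan S) : P f ∈ closedSpan T :=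
  Submodule.topologicalClosure_minimal _
    (t := (Submodule.span ℂ T).topologicalClosure.comap (P : E →ₗ[ℂ] E'))
    (Submodule.span_le.2 h) ((Submodule.isClosed_topologicalClosure _).preimage P.continuous) hf

theorem preimage_closedSpan_image (F : E ≃ₗᵢ[ℂ] E') (S : Set E) :
    F ⁻¹' closedSpan (F '' S) = closedSpan S := by
  ext f
  constructor
  · intro hf
    have := map_mem_closedSpan (F.symm : E' →L[ℂ] E) (T := S) (by
      rintro _ ⟨s, hs, rfl⟩
      simpa using subset_closedSpan S hs) hf
    simpa using this
  · exact map_mem_closedSpan (F : E →L[ℂ] E') (T := F '' S) fun s hs =>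
      subset_closedSpan _ ⟨s, hs, rfl⟩

theorem mem_closedSpan_singleton {a f : E} : f ∈ closedSpan {a} ↔ ∃ c : ℂ, c • a = f := by
  rw [← Submodule.mem_span_singleton, closedSpan,
    (Submodule.closed_of_finiteDimensional (Submodule.span ℂ {a})).submodule_topologicalClosure_eq]
  rfl

theorem exists_norm_one_smul_eq {a a' : E} (ha : ‖a‖ = 1) (ha' : ‖a'‖ = 1)
    (h : a' ∈ closedSpan {a}) : ∃ c : ℂ, ‖c‖ = 1 ∧ a' = c • a := by
  obtain ⟨c, rfl⟩ := mem_closedSpan_singleton.1 h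
  rw [norm_smul, ha, mul_one] at ha'
  exact ⟨c, ha', rfl⟩

theorem inner_eq_zero_of_mem_closedSpan {S : Set E} {q f : E} (h : ∀ s ∈ S, inner ℂ s q = 0)
    (hf : f ∈ closedSpan S) : inner ℂ f q = 0 := by
  have h0 : Submodule.span ℂ S ⟂ Submodule.span ℂ {q} :=
    Submodule.isOrtho_span.2 fun s hs t ht => by rw [mem_singleton_iff.1 ht]; exact h s hs
  have h1 : q ∈ (Submodule.span ℂ S)ᗮ := h0.symm (Submodule.mem_span_singleton_self q)
  rw [← Submodule.orthogonal_closure] at h1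
  exact (Submodule.mem_orthogonal _ _).1 h1 f hf

theorem mem_closedSpan_of_orthogonal [CompleteSpace E] {S : Set E} {f : E}
    (h : ∀ q, (∀ s ∈ S, inner ℂ s q = 0) → inner ℂ q f = 0) : f ∈ closedSpan S := by
  have : f ∈ (Submodule.span ℂ S).topologicalClosureᗮᗮ := by
    rw [Submodule.orthogonal_closure, Submodule.mem_orthogonal]
    exact fun q hq => h q fun s hs => (Submodule.mem_orthogonal _ _).1 hq s
      (Submodule.subset_span hs)
  rwa [Submodule.orthogonal_orthogonal] at this

end ClosedSpan

/-! ### Rigid functions and their fields of constants -/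

section Rigid

variable {H : Type*} [NormedAddCommGroup H] [InnerProductSpace ℂ H]

/-- Pettis' theorem in a Hilbert space with a countable basis: weak measurability implies strong
measurability. -/
theorem stronglyMeasurable_of_inner {ι : Type*} [Countable ι] (b : HilbertBasis ι ℂ H)
    {f : Circle → H} (h : ∀ g : H, Measurable fun ω => (inner ℂ g (f ω) : ℂ)) :
    StronglyMeasurable f := by
  refine stronglyMeasurable_of_tendsto (Filter.atTop : Filter (Finset ι))
    (f := fun s ω => ∑ i ∈ s, (inner ℂ (b i) (f ω) : ℂ) • b i) (fun s => ?_)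
    (tendsto_pi_nhds.2 fun ω => ?_)
  · exact Finset.stronglyMeasurable_fun_sum _ fun i _ => (h _).stronglyMeasurable.smul_const _
  · have := b.hasSum_repr (f ω)
    simp only [b.repr_apply_apply] at this
    exact this

theorem WeaklyMeasurable.stronglyMeasurable {ι : Type*} [Countable ι] (b : HilbertBasis ι ℂ H)
    {A : Circle → H →L[ℂ] H} (hA : WeaklyMeasurable A) (h : H) :
    StronglyMeasurable fun ω => A ω h :=
  stronglyMeasurable_of_inner b fun g => hA h g

theorem weaklyMeasurable_of_stronglyMeasurable {A : Circle → H →L[ℂ] H}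
    (hA : ∀ h, StronglyMeasurable fun ω => A ω h) : WeaklyMeasurable A :=
  fun h _ => (stronglyMeasurable_const.inner (hA h)).measurable

theorem IsRigidWith.isClosed {A : Circle → H →L[ℂ] H} {N : Submodule ℂ H}
    (hA : IsRigidWith A N) : IsClosed (N : Set H) :=
  hA.isPartialIsometry.exists.choose_spec.isClosed

theorem IsPartialIsometryWith.map_starProjection {B : H →L[ℂ] H} {N : Submodule ℂ H}
    (hB : IsPartialIsometryWith B N) [N.HasOrthogonalProjection] (h : H) :
    B (N.starProjection h) = B h := by
  have := hB.map_orthogonal _ (Submodule.sub_starProjection_mem_orthogonal (K := N) h)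
  rw [map_sub, sub_eq_zero] at this
  exact this.symm

theorem exists_mem_norm_eq_one {N : Submodule ℂ H} (hN : Module.finrank ℂ N = 1) :
    ∃ x ∈ N, ‖x‖ = 1 := by
  obtain ⟨v, hv, -⟩ := finrank_eq_one_iff'.1 hN
  exact ⟨_, N.smul_mem ((‖(v : H)‖⁻¹ : ℝ) : ℂ) v.2, by
    rw [norm_smul, Complex.norm_real, norm_inv, norm_norm,
      inv_mul_cancel₀ (norm_ne_zero_iff.2 fun h => hv (Subtype.ext h))]⟩

theorem ae_norm_eq_one_of_ae_inner {a : L2T H}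
    (h : ∀ᵐ ω ∂circleMeasure, inner ℂ (a ω) (a ω) = (1 : ℂ)) :
    ∀ᵐ ω ∂circleMeasure, ‖a ω‖ = 1 := by
  filter_upwards [h] with ω hω
  rw [norm_eq_sqrt_re_inner (𝕜 := ℂ), hω]; simp

/-- Every function `a` of pointwise norm one spans `⟨A 𝔠⟩` for the rigid function
`A(ω) = ⟪e, ·⟫ a(ω)`, where `e` is any fixed unit vector. -/
theorem exists_rigid_of_unit_field {a : L2T H} (ha : ∀ᵐ ω ∂circleMeasure, ‖a ω‖ = 1) :
    ∃ (A : Circle → H →L[ℂ] H) (N : Submodule ℂ H), IsRigidWith A N ∧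
      Module.finrank ℂ N = 1 ∧ closedSpan (constImage A) = closedSpan {a} := by
  obtain ⟨ω₀, he⟩ := ha.exists
  set e : H := a ω₀
  have he0 : e ≠ 0 := norm_ne_zero_iff.1 (by rw [he]; exact one_ne_zero)
  let A : Circle → H →L[ℂ] H := fun ω => (innerSL ℂ e).smulRight (a ω)
  have hAapp : ∀ ω h, A ω h = (inner ℂ e h : ℂ) • a ω := fun ω h => rfl
  refine ⟨A, Submodule.span ℂ {e}, ⟨weaklyMeasurable_of_stronglyMeasurable fun h => ?_, ?_⟩,
    finrank_span_singleton he0, ?_⟩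
  · simp only [hAapp]
    exact (Lp.stronglyMeasurable a).const_smul _
  · filter_upwards [ha] with ω hω
    refine ⟨Submodule.closed_of_finiteDimensional _, fun x hx => ?_, fun x hx => ?_⟩
    · obtain ⟨c, rfl⟩ := Submodule.mem_span_singleton.1 hx
      rw [hAapp, norm_smul, hω, inner_smul_right, inner_self_eq_norm_sq_to_K, norm_smul, he]
      simp
    · rw [hAapp, (Submodule.mem_orthogonal _ _).1 hx e (Submodule.mem_span_singleton_self e),
        zero_smul]
  · apply Subset.antisymm
    · refine closedSpan_subset ?_
      rintro f ⟨h, hf⟩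
      refine mem_closedSpan_singleton.2 ⟨inner ℂ e h, Lp.ext ?_⟩
      filter_upwards [hf, Lp.coeFn_smul (inner ℂ e h : ℂ) a] with ω h1 h2
      rw [h1, h2, Pi.smul_apply, hAapp]
    · refine closedSpan_subset (singleton_subset_iff.2 (subset_closedSpan _ ⟨e, ?_⟩))
      refine .of_forall fun ω => ?_
      change a ω = (inner ℂ e e : ℂ) • a ω
      rw [inner_self_eq_norm_sq_to_K, he]
      simp

/-- If `⟨A 𝔠⟩` is spanned by `a`, then `⟨ω ^ k A 𝔠⟩` is spanned by the functions `ω ^ k a`. -/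
theorem closedSpan_shiftedConstImage {A : Circle → H →L[ℂ] H} {a : L2T H}
    (h : closedSpan (constImage A) = closedSpan {a}) :
    closedSpan (shiftedConstImage A) = closedSpan (Set.range fun k : ℤ => shift k a) := by
  apply Subset.antisymm
  · refine closedSpan_subset ?_
    rintro f ⟨k, x, hf⟩
    have h1 : shift (-k) f ∈ constImage A := by
      refine ⟨x, ?_⟩
      filter_upwards [coeFn_shift (-k) f, hf] with ω h2 h3
      rw [h2, h3, smul_smul, ← zpow_add₀ (Circle.coe_ne_zero ω), neg_add_cancel, zpow_zero,
        one_smul]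
    obtain ⟨c, hc⟩ := mem_closedSpan_singleton.1 (h ▸ subset_closedSpan _ h1)
    have h2 : f = c • shift k a := by
      rw [← map_smul, hc, shift_shift, add_neg_cancel, shift_zero]
    rw [h2]
    exact (Submodule.span ℂ _).topologicalClosure.smul_mem c (subset_closedSpan _ ⟨k, rfl⟩)
  · refine closedSpan_subset ?_
    rintro _ ⟨k, rfl⟩
    have ha : a ∈ closedSpan (constImage A) := by
      rw [h]; exact subset_closedSpan _ (mem_singleton a)
    refine map_mem_closedSpan (shift k).toContinuousLinearMap ?_ ha
    rintro f ⟨x, hf⟩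
    have h1 : shift k f ∈ shiftedConstImage A := by
      refine ⟨k, x, ?_⟩
      filter_upwards [coeFn_shift k f, hf] with ω h1 h2
      rw [h1, h2]
    exact subset_closedSpan _ h1

variable [CompleteSpace H] {ι : Type*} [Countable ι] (b : HilbertBasis ι ℂ H)
  {A A' : Circle → H →L[ℂ] H} {N N' : Submodule ℂ H}

theorem IsPartialIsometryWith.norm_apply_le {B : H →L[ℂ] H} (hB : IsPartialIsometryWith B N)
    (h : H) : ‖B h‖ ≤ ‖h‖ := by
  have : CompleteSpace N := hB.isClosed.completeSpace_coe
  rw [← hB.map_starProjection, hB.norm_map _ (Submodule.starProjection_apply_mem N h)]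
  exact Submodule.norm_starProjection_apply_le N h

include b in
theorem IsRigidWith.memLp (hA : IsRigidWith A N) (h : H) :
    MemLp (fun ω => A ω h) 2 circleMeasure :=
  .of_bound (hA.weaklyMeasurable.stronglyMeasurable b h).aestronglyMeasurable ‖h‖
    (by filter_upwards [hA.isPartialIsometry] with ω hω using hω.norm_apply_le h)

/-- The operator `h ↦ A h` from `H` to `L²(∂𝔻; H)` attached to a rigid function `A`, where `A h`
is the function `ω ↦ A(ω) h`. The Hilbert basis only serves to prove strong measurability. -/
def constField (hA : IsRigidWith A N) : H →L[ℂ] L2T H :=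
  LinearMap.mkContinuous
    { toFun := fun h => (hA.memLp b h).toLp _
      map_add' := fun h k => by
        rw [← MemLp.toLp_add]
        exact MemLp.toLp_congr _ _ (.of_forall fun ω => by simp)
      map_smul' := fun c h => by
        rw [RingHom.id_apply, ← MemLp.toLp_const_smul]
        exact MemLp.toLp_congr _ _ (.of_forall fun ω => by simp) }
    1 fun h => by
      refine (Lp.norm_le_of_ae_bound (norm_nonneg h) ?_).trans ?_
      · filter_upwards [(hA.memLp b h).coeFn_toLp, hA.isPartialIsometry] with ω h1 h2
        simp only [LinearMap.coe_mk, AddHom.coe_mk]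
        rw [h1]; exact h2.norm_apply_le h
      · simp [measureUnivNNReal]

theorem coeFn_constField (hA : IsRigidWith A N) (h : H) :
    constField b hA h =ᵐ[circleMeasure] fun ω => A ω h :=
  (hA.memLp b h).coeFn_toLp

theorem ae_eq_iff_eq_constField (hA : IsRigidWith A N) (h : H) (f : L2T H) :
    f =ᵐ[circleMeasure] (fun ω => A ω h) ↔ f = constField b hA h :=
  ⟨fun hf => Lp.ext (hf.trans (coeFn_constField b hA h).symm),
    fun hf => hf ▸ coeFn_constField b hA h⟩

theorem ae_inner_constField (hA : IsRigidWith A N) {h k : H} (hh : h ∈ N) (hk : k ∈ N) :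
    ∀ᵐ ω ∂circleMeasure,
      inner ℂ (constField b hA h ω) (constField b hA k ω) = (inner ℂ h k : ℂ) := by
  filter_upwards [coeFn_constField b hA h, coeFn_constField b hA k, hA.isPartialIsometry]
    with ω h1 h2 h3
  rw [h1, h2]
  let Φ : N →ₗᵢ[ℂ] H := ⟨(A ω : H →ₗ[ℂ] H) ∘ₗ N.subtype, fun x => h3.norm_map x x.2⟩
  exact Φ.inner_map_map ⟨h, hh⟩ ⟨k, hk⟩

theorem inner_constField (hA : IsRigidWith A N) {h k : H} (hh : h ∈ N) (hk : k ∈ N) :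
    inner ℂ (constField b hA h) (constField b hA k) = (inner ℂ h k : ℂ) := by
  have := inner_shift_of_ae_inner_eq (ae_inner_constField b hA hh hk) 0 0
  rwa [shift_zero, shift_zero, if_pos rfl] at this

theorem norm_constField (hA : IsRigidWith A N) {h : H} (hh : h ∈ N) :
    ‖constField b hA h‖ = ‖h‖ := by
  rw [norm_eq_sqrt_re_inner (𝕜 := ℂ), norm_eq_sqrt_re_inner (𝕜 := ℂ),
    inner_constField b hA hh hh]

/-- The operator `h ↦ A h`, restricted to the initial space of `A`, as an isometry. -/
def constFieldIso (hA : IsRigidWith A N) : N →ₗᵢ[ℂ] L2T H where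
  toLinearMap := (constField b hA : H →ₗ[ℂ] L2T H) ∘ₗ N.subtype
  norm_map' x := norm_constField b hA x.2

theorem constField_starProjection (hA : IsRigidWith A N) [N.HasOrthogonalProjection] (h : H) :
    constField b hA (N.starProjection h) = constField b hA h := by
  ext1
  filter_upwards [coeFn_constField b hA (N.starProjection h), coeFn_constField b hA h,
    hA.isPartialIsometry] with ω h1 h2 h3
  rw [h1, h2, h3.map_starProjection]

theorem constImage_eq_range (hA : IsRigidWith A N) :
    constImage A = ((constFieldIso b hA).range : Set (L2T H)) := by
  have : CompleteSpace N := hA.isClosed.completeSpace_coe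
  ext f
  constructor
  · rintro ⟨h, hf⟩
    refine ⟨⟨N.starProjection h, Submodule.starProjection_apply_mem N h⟩, ?_⟩
    change constField b hA (N.starProjection h) = f
    rw [constField_starProjection, (ae_eq_iff_eq_constField b hA h f).1 hf]
  · rintro ⟨x, rfl⟩
    exact ⟨x, coeFn_constField b hA x⟩

include b in
/-- The space `A 𝔠` is already a closed subspace. -/
theorem closedSpan_constImage (hA : IsRigidWith A N) :
    closedSpan (constImage A) = constImage A := by
  have : CompleteSpace N := hA.isClosed.completeSpace_coe
  have hcl : IsClosed ((constFieldIso b hA).range : Set (L2T H)) := by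
    have := (constFieldIso b hA).isometry.isClosedEmbedding.isClosed_range
    exact this
  rw [constImage_eq_range b hA, closedSpan, Submodule.span_eq, hcl.submodule_topologicalClosure_eq]

include b in
/-- A rigid function is determined by the space `⟨A 𝔠⟩` up to a constant right factor. -/
theorem eqUpToRightFactor_of_closedSpan_eq (hA : IsRigidWith A N) (hA' : IsRigidWith A' N')
    (h : closedSpan (constImage A) = closedSpan (constImage A')) : EqUpToRightFactor A A' := by
  have : CompleteSpace N := hA.isClosed.completeSpace_coe
  have : CompleteSpace N' := hA'.isClosed.completeSpace_coe
  have hr : (constFieldIso b hA').range = (constFieldIso b hA).range := by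
    apply SetLike.coe_injective
    rw [← constImage_eq_range, ← constImage_eq_range, ← closedSpan_constImage b hA',
      ← closedSpan_constImage b hA, h]
  let W : N' ≃ₗᵢ[ℂ] N := (constFieldIso b hA').equivRange.trans
    ((LinearIsometryEquiv.ofEq _ _ hr).trans (constFieldIso b hA).equivRange.symm)
  have hW : ∀ x : N', constField b hA (W x) = constField b hA' x := by
    intro x
    have h1 : (constFieldIso b hA).equivRange (W x)
        = LinearIsometryEquiv.ofEq _ _ hr ((constFieldIso b hA').equivRange x) := by simp [W]
    exact congrArg Subtype.val h1
  let U : H →L[ℂ] H := N.subtypeL ∘L (W : N' →L[ℂ] N) ∘L N'.orthogonalProjectionOnto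
  have hU : ∀ x : N', U x = W x := by
    intro x
    simp [U]
  refine ⟨N, N', U, hA, hA', ⟨hA'.isClosed, fun x hx => ?_, fun x hx => ?_⟩, ?_, ?_⟩
  · rw [hU ⟨x, hx⟩]; exact W.norm_map ⟨x, hx⟩
  · simp [U, Submodule.orthogonalProjectionOnto_eq_zero_iff.2 hx]
  · ext y
    constructor
    · rintro ⟨x, hx, rfl⟩
      rw [hU ⟨x, hx⟩]; exact (W _).2
    · intro hy
      refine ⟨W.symm ⟨y, hy⟩, (W.symm ⟨y, hy⟩).2, ?_⟩
      rw [hU, LinearIsometryEquiv.apply_symm_apply]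
  · have hb : ∀ᵐ ω ∂circleMeasure, ∀ i, A' ω (b i) = A ω (U (b i)) := by
      refine ae_all_iff.2 fun i => ?_
      have h1 : constField b hA' (b i) = constField b hA (U (b i)) := by
        rw [← constField_starProjection b hA']
        exact (hW (N'.orthogonalProjectionOnto (b i))).symm
      have h2 := coeFn_constField b hA' (b i)
      rw [h1] at h2
      filter_upwards [h2, coeFn_constField b hA (U (b i))] with ω h3 h4
      rw [← h3, h4]
    filter_upwards [hb] with ω hω
    refine ContinuousLinearMap.ext_on
      (Submodule.dense_iff_topologicalClosure_eq_top.2 b.dense_span) ?_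
    rintro _ ⟨i, rfl⟩
    exact hω i

theorem closedSpan_constImage_eq_singleton (hA : IsRigidWith A N) (hN : Module.finrank ℂ N = 1)
    {x : H} (hx : x ∈ N) (hx0 : x ≠ 0) :
    closedSpan (constImage A) = closedSpan {constField b hA x} := by
  rw [closedSpan_constImage b hA, constImage_eq_range b hA]
  ext f
  rw [mem_closedSpan_singleton]
  constructor
  · rintro ⟨y, rfl⟩
    obtain ⟨c, hc⟩ := (finrank_eq_one_iff_of_nonzero' (⟨x, hx⟩ : N)
      fun h => hx0 (congrArg Subtype.val h)).1 hN y
    refine ⟨c, ?_⟩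
    rw [← hc, ← map_smul]; rfl
  · rintro ⟨c, rfl⟩
    exact ⟨c • ⟨x, hx⟩, (constFieldIso b hA).map_smul c ⟨x, hx⟩⟩

include b in
/-- A sequence of fields `g k` that is a Hilbert basis in almost every fibre spans `⟨C 𝔠⟩` for a
unitary-valued function `C`: fix a good point `ω₀` and let `C(ω)` map `g k ω₀` to `g k ω`. -/
theorem exists_unitary_of_basis_field {κ : Type*} [Countable κ] {g : κ → L2T H}
    (h1 : ∀ᵐ ω ∂circleMeasure, Orthonormal ℂ fun k => g k ω)
    (h2 : ∀ᵐ ω ∂circleMeasure, closedSpan (Set.range fun k => g k ω) = Set.univ) :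
    ∃ C : Circle → H →L[ℂ] H, IsRigid C ∧
      (∀ᵐ ω ∂circleMeasure, C ω ∈ unitary (H →L[ℂ] H)) ∧
      closedSpan (constImage C) = closedSpan (Set.range g) := by
  classical
  obtain ⟨S, hS, hSm, hSgood⟩ := (h1.and h2).exists_measurable_mem
  have hbasis : ∀ ω ∈ S, ∃ B : HilbertBasis κ ℂ H, ∀ k, B k = g k ω := by
    intro ω hω
    have hsp : ⊤ ≤ (Submodule.span ℂ (Set.range fun k => g k ω)).topologicalClosure :=
      fun x _ => (hSgood ω hω).2.superset (mem_univ x)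
    exact ⟨HilbertBasis.mk (hSgood ω hω).1 hsp, fun k => by rw [HilbertBasis.coe_mk]⟩
  have hS' : ∀ᵐ ω ∂circleMeasure, ω ∈ S := hS
  obtain ⟨ω₀, hω₀⟩ := hS'.exists
  obtain ⟨e, he⟩ := hbasis ω₀ hω₀
  -- off the measurable set `S` of good points the operator is the identity, so that `C` is weakly
  -- measurable everywhere and not only up to a null set
  have hex : ∀ ω, ∃ W : H ≃ₗᵢ[ℂ] H, ∀ k, W (e k) = if ω ∈ S then g k ω else e k := by
    intro ω
    by_cases hω : ω ∈ S
    · obtain ⟨B, hB⟩ := hbasis ω hω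
      exact ⟨basisTransfer e B, fun k => by rw [basisTransfer_apply_basis, hB, if_pos hω]⟩
    · exact ⟨.refl ℂ H, fun k => by rw [if_neg hω]; rfl⟩
  choose W hW using hex
  let C : Circle → H →L[ℂ] H := fun ω => (W ω : H →L[ℂ] H)
  have hCapp : ∀ ω h, C ω h = W ω h := fun ω h => rfl
  -- expand `h` in the basis `e`, whose images under `C(ω)` depend measurably on `ω`
  have hmeas : ∀ h, StronglyMeasurable fun ω => C ω h := by
    intro h
    refine stronglyMeasurable_of_tendsto (Filter.atTop : Filter (Finset κ))
      (f := fun s ω => ∑ k ∈ s, (inner ℂ (e k) h : ℂ) • C ω (e k)) (fun s => ?_)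
      (tendsto_pi_nhds.2 fun ω => ?_)
    · refine Finset.stronglyMeasurable_fun_sum _ fun k _ => StronglyMeasurable.const_smul ?_ _
      simp only [hCapp, hW]
      exact StronglyMeasurable.ite hSm (Lp.stronglyMeasurable (g k)) stronglyMeasurable_const
    · have := (e.hasSum_repr h).mapL (C ω)
      simp only [e.repr_apply_apply, map_smul] at this
      exact this
  have hrigid : IsRigidWith C ⊤ := by
    refine ⟨weaklyMeasurable_of_stronglyMeasurable hmeas, .of_forall fun ω => ⟨isClosed_univ,
      fun x _ => (W ω).norm_map x, fun x hx => ?_⟩⟩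
    rw [Submodule.top_orthogonal_eq_bot, Submodule.mem_bot] at hx
    rw [hx, map_zero]
  have hfield : ∀ k, constField b hrigid (e k) = g k := by
    intro k
    ext1
    filter_upwards [coeFn_constField b hrigid (e k), hS'] with ω h3 h4
    rw [h3, hCapp, hW, if_pos h4]
  refine ⟨C, ⟨⊤, hrigid⟩, .of_forall fun ω => (Unitary.linearIsometryEquiv.symm (W ω)).2, ?_⟩
  apply Subset.antisymm
  · refine closedSpan_subset ?_
    rintro f ⟨h, hf⟩
    rw [(ae_eq_iff_eq_constField b hrigid h f).1 hf]
    refine map_mem_closedSpan (S := Set.range e) (constField b hrigid) ?_ ?_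
    · rintro _ ⟨k, rfl⟩
      rw [hfield]; exact subset_closedSpan _ ⟨k, rfl⟩
    · rw [closedSpan, e.dense_span]; trivial
  · refine closedSpan_subset ?_
    rintro _ ⟨k, rfl⟩
    exact subset_closedSpan _ ⟨e k, hfield k ▸ coeFn_constField b hrigid (e k)⟩

end Rigid

/-! ### Range functions of rank one -/

section Range

variable {H : Type*} [NormedAddCommGroup H] [InnerProductSpace ℂ H] [CompleteSpace H]

/-- If `a` has pointwise norm one, the fields with values in the lines `ℂ a(ω)` form the closed
span of the functions `ω ^ k a`. -/
theorem rangeSpace_eq_closedSpan_shift {R : Circle → ClosedSubmodule ℂ H} {a : L2T H}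
    (hR : ∀ᵐ ω ∂circleMeasure, (R ω : Submodule ℂ H) = Submodule.span ℂ {a ω}) :
    rangeSpace R = closedSpan (Set.range fun k : ℤ => shift k a) := by
  apply Subset.antisymm
  · intro f hf
    refine mem_closedSpan_of_orthogonal fun q hq => ?_
    have h1 := ae_inner_eq_zero (f := a) (g := q) fun n => hq _ ⟨n, rfl⟩
    rw [L2.inner_def]
    refine integral_eq_zero_of_ae ?_
    have hf' : ∀ᵐ ω ∂circleMeasure, f ω ∈ R ω := hf
    filter_upwards [h1, hR, hf'] with ω h2 h3 h4
    have h5 : f ω ∈ (R ω : Submodule ℂ H) := h4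
    rw [h3] at h5
    obtain ⟨c, hc⟩ := Submodule.mem_span_singleton.1 h5
    rw [← hc, inner_smul_right, inner_eq_zero_symm.1 h2, mul_zero]; rfl
  · intro f hf
    refine ae_mem_of_mem_closedSpan (V := fun ω => (R ω : Submodule ℂ H))
      (fun ω => (R ω).isClosed) ?_ hf
    rintro _ ⟨k, rfl⟩
    filter_upwards [coeFn_shift k a, hR] with ω h1 h2
    rw [h1, h2]
    exact Submodule.smul_mem _ _ (Submodule.mem_span_singleton_self _)

theorem isMeasurableRange_span_singleton {a : Circle → H} (ha : StronglyMeasurable a) :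
    IsMeasurableRange fun ω => (⟨Submodule.span ℂ {a ω},
      Submodule.closed_of_finiteDimensional _⟩ : ClosedSubmodule ℂ H) := by
  refine weaklyMeasurable_of_stronglyMeasurable fun h => ?_
  have : (fun ω => (inner ℂ (a ω) h / ((‖a ω‖ ^ 2 : ℝ) : ℂ)) • a ω)
      = fun ω => (Submodule.span ℂ {a ω}).starProjection h := by
    funext ω
    rw [Submodule.starProjection_singleton]; rfl
  have h2 : StronglyMeasurable fun ω => (inner ℂ (a ω) h / ((‖a ω‖ ^ 2 : ℝ) : ℂ)) • a ω := by
    refine StronglyMeasurable.smul (Measurable.stronglyMeasurable ?_) ha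
    exact (ha.inner stronglyMeasurable_const).measurable.div
      (Complex.measurable_ofReal.comp (ha.norm.measurable.pow_const 2))
  rw [this] at h2
  exact h2

end Range

/-! ### Wavelets and compatible triples -/

section Wavelet

variable {H₁ H₂ : Type*} [NormedAddCommGroup H₁] [InnerProductSpace ℂ H₁]
  [NormedAddCommGroup H₂] [InnerProductSpace ℂ H₂]
  {F : L2R ≃ₗᵢ[ℂ] L2T H₁} {G : L2R ≃ₗᵢ[ℂ] L2T H₂}

theorem image_range_translate (hF : ∀ k f, F (translate k f) = shift k (F f)) (ψ : L2R) :
    F '' (Set.range fun k : ℤ => translate k ψ) = Set.range fun k : ℤ => shift k (F ψ) := by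
  rw [← Set.range_comp]
  exact congrArg Set.range (funext fun k => hF k ψ)

theorem preimage_closedSpan_range_shift (hF : ∀ k f, F (translate k f) = shift k (F f))
    (ψ : L2R) :
    F ⁻¹' closedSpan (Set.range fun k : ℤ => shift k (F ψ))
      = closedSpan (Set.range fun k : ℤ => translate k ψ) := by
  rw [← image_range_translate hF, preimage_closedSpan_image]

theorem closedSpan_singleton_eq_preimage_iff {H : Type*} [NormedAddCommGroup H]
    [InnerProductSpace ℂ H] (F : L2R ≃ₗᵢ[ℂ] L2T H) (ψ : L2R) (X : Set (L2T H)) :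
    closedSpan {ψ} = F ⁻¹' X ↔ X = closedSpan {F ψ} := by
  rw [← preimage_closedSpan_image F, image_singleton, F.surjective.preimage_injective.eq_iff,
    eq_comm]

theorem condLine_iff {ψ : L2R} {A : Circle → H₁ →L[ℂ] H₁} {B : Circle → H₂ →L[ℂ] H₂} :
    CondLine F G ψ A B ↔
      closedSpan (constImage A) = closedSpan {F ψ} ∧
      closedSpan (constImage B) = closedSpan {G ψ} := by
  rw [CondLine, closedSpan_singleton_eq_preimage_iff, closedSpan_singleton_eq_preimage_iff]

theorem CondLine.preimage_shifted (hF : ∀ k f, F (translate k f) = shift k (F f)) {ψ : L2R}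
    {A : Circle → H₁ →L[ℂ] H₁} {B : Circle → H₂ →L[ℂ] H₂} (h : CondLine F G ψ A B) :
    F ⁻¹' closedSpan (shiftedConstImage A)
      = closedSpan (Set.range fun k : ℤ => translate k ψ) := by
  rw [closedSpan_shiftedConstImage (condLine_iff.1 h).1, preimage_closedSpan_range_shift hF]

theorem IsOrthonormalWavelet.norm_eq_one {ψ : L2R} (hψ : IsOrthonormalWavelet ψ) : ‖ψ‖ = 1 := by
  simpa only [translate_zero, dilate_zero] using hψ.1.1 (0, 0)

theorem IsOrthonormalWavelet.orthonormal_translate {ψ : L2R} (hψ : IsOrthonormalWavelet ψ) :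
    Orthonormal ℂ fun k : ℤ => translate k ψ := by
  have := hψ.1.comp (fun k : ℤ => ((0 : ℤ), k)) fun k l h => (Prod.mk.inj h).2
  simpa only [Function.comp_def, dilate_zero] using this

/-- If the integer translates of `ψ` are orthonormal, the translation model of `ψ` has pointwise
norm one. -/
theorem ae_norm_model_eq_one (hF : ∀ k f, F (translate k f) = shift k (F f)) {ψ : L2R}
    (hψ : Orthonormal ℂ fun k : ℤ => translate k ψ) :
    ∀ᵐ ω ∂circleMeasure, ‖F ψ ω‖ = 1 := by
  have h0 : inner ℂ (F ψ) (F ψ) = (1 : ℂ) := by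
    have := orthonormal_iff_ite.1 hψ 0 0
    rwa [translate_zero, if_pos rfl, ← F.inner_map_map] at this
  have h1 := ae_inner_eq_of_inner_shift_eq_zero (f := F ψ) (g := F ψ) fun n hn => by
    have := orthonormal_iff_ite.1 hψ n 0
    rwa [translate_zero, if_neg hn, ← F.inner_map_map, hF] at this
  rw [h0] at h1
  exact ae_norm_eq_one_of_ae_inner h1

/-- The dilation model of the translates of a wavelet: since the dilates of their span are
mutually orthogonal, these fields are orthonormal in almost every fibre. -/
theorem ae_orthonormal_model (hG : ∀ k f, G (dilate k f) = shift k (G f)) {ψ : L2R}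
    (hψ : IsOrthonormalWavelet ψ) :
    ∀ᵐ ω ∂circleMeasure, Orthonormal ℂ fun k : ℤ => G (translate k ψ) ω := by
  have h : ∀ᵐ ω ∂circleMeasure, ∀ k l : ℤ,
      inner ℂ (G (translate k ψ) ω) (G (translate l ψ) ω) = if k = l then (1 : ℂ) else 0 := by
    refine ae_all_iff.2 fun k => ae_all_iff.2 fun l => ?_
    rw [← orthonormal_iff_ite.1 hψ.orthonormal_translate k l, ← G.inner_map_map]
    refine ae_inner_eq_of_inner_shift_eq_zero fun n hn => ?_
    have := orthonormal_iff_ite.1 hψ.1 (n, k) (0, l)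
    rw [if_neg (by simp [hn]), dilate_zero, ← G.inner_map_map, hG] at this
    exact this
  filter_upwards [h] with ω hω using orthonormal_iff_ite.2 hω

/-- The dilation models of the translates of a wavelet are total in almost every fibre: the constant
fields `b i` are limits of combinations of shifts of these models. -/
theorem ae_total_model {ι : Type*} [Countable ι] (b : HilbertBasis ι ℂ H₂)
    (hG : ∀ k f, G (dilate k f) = shift k (G f)) {ψ : L2R} (hψ : IsOrthonormalWavelet ψ) :
    ∀ᵐ ω ∂circleMeasure, closedSpan (Set.range fun k : ℤ => G (translate k ψ) ω) = Set.univ := by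
  let V : Circle → Submodule ℂ H₂ := fun ω =>
    (Submodule.span ℂ (Set.range fun k : ℤ => G (translate k ψ) ω)).topologicalClosure
  have hV : ∀ ω, IsClosed (V ω : Set H₂) := fun ω => Submodule.isClosed_topologicalClosure _
  have hall : ∀ f : L2T H₂, ∀ᵐ ω ∂circleMeasure, f ω ∈ V ω := by
    intro f
    have hf : G.symm f ∈ closedSpan
        (Set.range fun p : ℤ × ℤ => dilate p.1 (translate p.2 ψ)) := hψ.2 ▸ mem_univ _
    rw [← preimage_closedSpan_image G, mem_preimage, G.apply_symm_apply] at hf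
    refine ae_mem_of_mem_closedSpan hV ?_ hf
    rintro _ ⟨_, ⟨⟨j, k⟩, rfl⟩, rfl⟩
    simp only [hG]
    filter_upwards [coeFn_shift j (G (translate k ψ))] with ω h1
    rw [h1]
    exact (V ω).smul_mem _ (subset_closedSpan _ ⟨k, rfl⟩)
  have hb : ∀ᵐ ω ∂circleMeasure, ∀ i, b i ∈ V ω := by
    refine ae_all_iff.2 fun i => ?_
    filter_upwards [hall (monomial 0 (b i)), coeFn_monomial 0 (b i)] with ω h1 h2
    rwa [h2, zpow_zero, one_smul] at h1
  filter_upwards [hb] with ω hω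
  have htop : ⊤ ≤ V ω := by
    rw [← b.dense_span]
    refine Submodule.topologicalClosure_minimal _ (Submodule.span_le.2 ?_) (hV ω)
    rintro _ ⟨i, rfl⟩
    exact hω i
  exact eq_univ_of_forall fun x => htop Submodule.mem_top

/-- A function `ψ` whose translates are orthonormal and span `G⁻¹⟨C 𝔠⟩`, with `C` unitary-valued
almost everywhere, is an orthonormal wavelet: `C 𝔠` is a complete wandering subspace of the
shift. -/
theorem isOrthonormalWavelet_of_unitary [CompleteSpace H₂] {ι : Type*} [Countable ι]
    (b : HilbertBasis ι ℂ H₂)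
    (hG : ∀ k f, G (dilate k f) = shift k (G f)) {ψ : L2R}
    (hψ : Orthonormal ℂ fun k : ℤ => translate k ψ)
    {C : Circle → H₂ →L[ℂ] H₂} (hC : IsRigid C)
    (hCu : ∀ᵐ ω ∂circleMeasure, C ω ∈ unitary (H₂ →L[ℂ] H₂))
    (hspan : closedSpan (Set.range fun k : ℤ => translate k ψ)
      = G ⁻¹' closedSpan (constImage C)) : IsOrthonormalWavelet ψ := by
  obtain ⟨N, hN⟩ := hC
  have hmem : ∀ k : ℤ, ∃ x : N, constField b hN x = G (translate k ψ) := by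
    intro k
    have h1 : translate k ψ ∈ G ⁻¹' closedSpan (constImage C) :=
      hspan ▸ subset_closedSpan _ ⟨k, rfl⟩
    rw [mem_preimage, closedSpan_constImage b hN, constImage_eq_range b hN] at h1
    exact h1
  refine ⟨?_, ?_⟩
  · classical
    rw [orthonormal_iff_ite]
    rintro ⟨i, k⟩ ⟨j, l⟩
    obtain ⟨x, hx⟩ := hmem k
    obtain ⟨y, hy⟩ := hmem l
    have h1 : (inner ℂ (x : H₂) (y : H₂) : ℂ) = if k = l then 1 else 0 := by
      rw [← inner_constField b hN x.2 y.2, hx, hy, G.inner_map_map,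
        orthonormal_iff_ite.1 hψ k l]
    rw [← G.inner_map_map, hG, hG, ← hx, ← hy,
      inner_shift_of_ae_inner_eq (ae_inner_constField b hN x.2 y.2), h1]
    by_cases h2 : i = j <;> by_cases h3 : k = l <;> simp [h2, h3]
  · refine eq_univ_of_forall fun f => mem_closedSpan_of_orthogonal fun q hq => ?_
    -- `𝓖 q` is orthogonal to all shifts of `C b_i`, hence fibrewise orthogonal to `C(ω) b_i`
    have h1 : ∀ i, ∀ᵐ ω ∂circleMeasure, inner ℂ (C ω (b i)) (G q ω) = 0 := by
      intro i
      have h2 : constField b hN (b i) ∈ closedSpan (constImage C) :=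
        subset_closedSpan _ ⟨b i, coeFn_constField b hN (b i)⟩
      have h3 : G.symm (constField b hN (b i))
          ∈ closedSpan (Set.range fun k : ℤ => translate k ψ) := by
        rw [hspan, mem_preimage, G.apply_symm_apply]; exact h2
      rw [← preimage_closedSpan_image G, mem_preimage, G.apply_symm_apply] at h3
      have h4 : ∀ n : ℤ, inner ℂ (shift n (constField b hN (b i))) (G q) = 0 := by
        intro n
        have h5 := inner_eq_zero_of_mem_closedSpan (q := shift (-n) (G q)) (by
          rintro _ ⟨_, ⟨k, rfl⟩, rfl⟩
          rw [← LinearIsometry.inner_map_map (shift n), shift_shift, add_neg_cancel, shift_zero,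
            ← hG, G.inner_map_map]
          exact hq _ ⟨(n, k), rfl⟩) h3
        rwa [← LinearIsometry.inner_map_map (shift n), shift_shift, add_neg_cancel,
          shift_zero] at h5
      filter_upwards [ae_inner_eq_zero h4, coeFn_constField b hN (b i)] with ω h5 h6
      rwa [h6] at h5
    have hq0 : G q = 0 := by
      ext1
      filter_upwards [ae_all_iff.2 h1, hCu, Lp.coeFn_zero H₂ 2 circleMeasure] with ω h2 h3 h4
      have h5 : star (C ω) (G q ω) = 0 := by
        refine b.eq_zero_of_forall_inner fun i => ?_
        rw [ContinuousLinearMap.star_eq_adjoint, ContinuousLinearMap.adjoint_inner_right]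
        exact h2 i
      have h6 := DFunLike.congr_fun (Unitary.mul_star_self_of_mem h3) (G q ω)
      rw [mul_apply_eq_comp, h5, map_zero] at h6
      rw [h4]
      exact h6.symm
    rw [show q = 0 from G.map_eq_zero_iff.1 hq0, inner_zero_left]

theorem exists_triple [CompleteSpace H₁] [CompleteSpace H₂] {ι : Type*} [Countable ι]
    (b : HilbertBasis ι ℂ H₂)
    (hF : ∀ k f, F (translate k f) = shift k (F f))
    (hG : ∀ k f, G (dilate k f) = shift k (G f)) {ψ : L2R} (hψ : IsOrthonormalWavelet ψ) :
    ∃ (A : Circle → H₁ →L[ℂ] H₁) (NA : Submodule ℂ H₁)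
      (B C : Circle → H₂ →L[ℂ] H₂) (NB : Submodule ℂ H₂),
      CondRigid A NA B NB C ∧ CondCompat F G A C ∧ CondLine F G ψ A B := by
  obtain ⟨A, NA, hA, hA1, hAψ⟩ :=
    exists_rigid_of_unit_field (ae_norm_model_eq_one hF hψ.orthonormal_translate)
  have hGψ : ∀ᵐ ω ∂circleMeasure, ‖G ψ ω‖ = 1 := by
    filter_upwards [ae_orthonormal_model hG hψ] with ω hω
    simpa only [translate_zero] using hω.1 0
  obtain ⟨B, NB, hB, hB1, hBψ⟩ := exists_rigid_of_unit_field hGψ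
  obtain ⟨C, hC, hCu, hCψ⟩ := exists_unitary_of_basis_field b (ae_orthonormal_model hG hψ)
    (ae_total_model b hG hψ)
  have hline : CondLine F G ψ A B := condLine_iff.2 ⟨hAψ, hBψ⟩
  refine ⟨A, NA, B, C, NB, ⟨hA, hB, hC, hA1, hB1, hCu⟩, ?_, hline⟩
  rw [CondCompat, hline.preimage_shifted hF, hCψ]
  have : Set.range (fun k : ℤ => G (translate k ψ))
      = G '' Set.range (fun k : ℤ => translate k ψ) := by rw [← Set.range_comp]; rfl
  rw [this, preimage_closedSpan_image]

/-- Uniqueness of the triple of a wavelet: `ψ` determines the three spaces `⟨A 𝔠⟩`, `⟨B 𝔠⟩` and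
`⟨C 𝔠⟩`, the last one through the span of the translates of `ψ`. -/
theorem eqUpToRightFactor_triple [CompleteSpace H₁] [CompleteSpace H₂] {ι₁ ι₂ : Type*}
    [Countable ι₁] [Countable ι₂] (b₁ : HilbertBasis ι₁ ℂ H₁) (b₂ : HilbertBasis ι₂ ℂ H₂)
    (hF : ∀ k f, F (translate k f) = shift k (F f)) {ψ : L2R}
    {A A' : Circle → H₁ →L[ℂ] H₁} {NA NA' : Submodule ℂ H₁}
    {B B' C C' : Circle → H₂ →L[ℂ] H₂} {NB NB' : Submodule ℂ H₂}
    (h : CondRigid A NA B NB C) (h' : CondRigid A' NA' B' NB' C')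
    (hcompat : CondCompat F G A C) (hcompat' : CondCompat F G A' C')
    (hline : CondLine F G ψ A B) (hline' : CondLine F G ψ A' B') :
    EqUpToRightFactor A A' ∧ EqUpToRightFactor B B' ∧ EqUpToRightFactor C C' := by
  obtain ⟨hA, hB⟩ := condLine_iff.1 hline
  obtain ⟨hA', hB'⟩ := condLine_iff.1 hline'
  obtain ⟨N, hN⟩ := h.rigid_C
  obtain ⟨N', hN'⟩ := h'.rigid_C
  refine ⟨eqUpToRightFactor_of_closedSpan_eq b₁ h.rigid_A h'.rigid_A (hA.trans hA'.symm),
    eqUpToRightFactor_of_closedSpan_eq b₂ h.rigid_B h'.rigid_B (hB.trans hB'.symm),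
    eqUpToRightFactor_of_closedSpan_eq b₂ hN hN' ?_⟩
  rw [CondCompat, hline.preimage_shifted hF] at hcompat
  rw [CondCompat, hline'.preimage_shifted hF] at hcompat'
  exact G.surjective.preimage_injective (hcompat.symm.trans hcompat')

/-- Every unit vector in the initial space of the first function of a compatible triple yields an
orthonormal wavelet. -/
theorem exists_wavelet_of_triple [CompleteSpace H₁] [CompleteSpace H₂] {ι₁ ι₂ : Type*}
    [Countable ι₁] [Countable ι₂] (b₁ : HilbertBasis ι₁ ℂ H₁) (b₂ : HilbertBasis ι₂ ℂ H₂)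
    (hF : ∀ k f, F (translate k f) = shift k (F f))
    (hG : ∀ k f, G (dilate k f) = shift k (G f))
    {A : Circle → H₁ →L[ℂ] H₁} {NA : Submodule ℂ H₁}
    {B C : Circle → H₂ →L[ℂ] H₂} {NB : Submodule ℂ H₂}
    (h : CondRigid A NA B NB C) (hcompat : CondCompat F G A C)
    (hline : F ⁻¹' closedSpan (constImage A) = G ⁻¹' closedSpan (constImage B))
    {x : H₁} (hx : x ∈ NA) (hx1 : ‖x‖ = 1) :
    ∃ ψ : L2R,
      (∀ φ : L2R, F φ =ᵐ[circleMeasure] (fun ω => A ω x) ↔ φ = ψ) ∧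
      (∃! y : H₂, y ∈ NB ∧ ‖y‖ = 1 ∧
        ∀ φ : L2R, G φ =ᵐ[circleMeasure] (fun ω => B ω y) ↔ φ = ψ) ∧
      IsOrthonormalWavelet ψ ∧ CondLine F G ψ A B ∧
      (∀ ψ' : L2R, IsOrthonormalWavelet ψ' → CondLine F G ψ' A B →
        ∃ c : ℂ, ‖c‖ = 1 ∧ ψ' = c • ψ) := by
  set a : L2T H₁ := constField b₁ h.rigid_A x with ha
  set ψ : L2R := F.symm a with hψdef
  have hFψ : F ψ = a := F.apply_symm_apply a
  have hψ1 : ‖ψ‖ = 1 := by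
    rw [hψdef, LinearIsometryEquiv.norm_map, ha, norm_constField b₁ h.rigid_A hx, hx1]
  have hAa : closedSpan (constImage A) = closedSpan {F ψ} := by
    rw [hFψ]
    exact closedSpan_constImage_eq_singleton b₁ h.rigid_A h.finrank_A hx
      (norm_ne_zero_iff.1 (by rw [hx1]; exact one_ne_zero))
  have hψline : closedSpan {ψ} = F ⁻¹' closedSpan (constImage A) :=
    (closedSpan_singleton_eq_preimage_iff F ψ _).2 hAa
  have hcond : CondLine F G ψ A B := ⟨hψline, hψline.trans hline⟩
  have horth : Orthonormal ℂ fun k : ℤ => translate k ψ := by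
    classical
    rw [orthonormal_iff_ite]
    intro k l
    rw [← F.inner_map_map, hF, hF, hFψ,
      inner_shift_of_ae_inner_eq (ae_inner_constField b₁ h.rigid_A hx hx),
      inner_self_eq_norm_sq_to_K, hx1]
    simp
  have hwavelet : IsOrthonormalWavelet ψ :=
    isOrthonormalWavelet_of_unitary b₂ hG horth h.rigid_C h.unitary_C
      ((hcond.preimage_shifted hF).symm.trans hcompat)
  refine ⟨ψ, fun φ => ?_, ?_, hwavelet, hcond, fun ψ' hψ' hcond' => ?_⟩
  · rw [ae_eq_iff_eq_constField b₁ h.rigid_A, ← ha, hψdef, LinearIsometryEquiv.eq_symm_apply]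
  · have hiff : ∀ y : H₂, (∀ φ : L2R, G φ =ᵐ[circleMeasure] (fun ω => B ω y) ↔ φ = ψ) ↔
        constField b₂ h.rigid_B y = G ψ := by
      intro y
      simp only [ae_eq_iff_eq_constField b₂ h.rigid_B]
      constructor
      · exact fun hy => ((hy ψ).2 rfl).symm
      · exact fun hy φ => by rw [hy, G.injective.eq_iff]
    have hmem : G ψ ∈ constImage B := by
      rw [← closedSpan_constImage b₂ h.rigid_B, (condLine_iff.1 hcond).2]
      exact subset_closedSpan _ (mem_singleton _)
    rw [constImage_eq_range b₂ h.rigid_B] at hmem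
    obtain ⟨y, hy⟩ := hmem
    have hy' : constField b₂ h.rigid_B y = G ψ := hy
    refine ⟨y, ⟨y.2, ?_, (hiff y).2 hy'⟩, ?_⟩
    · rw [← norm_constField b₂ h.rigid_B y.2, hy', G.norm_map, hψ1]
    · rintro z ⟨hz, -, hz'⟩
      have : constFieldIso b₂ h.rigid_B ⟨z, hz⟩ = constFieldIso b₂ h.rigid_B y :=
        ((hiff z).1 hz').trans hy'.symm
      exact congrArg Subtype.val ((constFieldIso b₂ h.rigid_B).injective this)
  · refine exists_norm_one_smul_eq hψ1 hψ'.norm_eq_one ?_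
    rw [hcond.1, ← hcond'.1]
    exact subset_closedSpan _ (mem_singleton _)

/-- The range function of a compatible triple is `ω ↦ ℂ A(ω) x`, with `x` a unit vector in the
initial space of `A`. -/
theorem exists_range_of_triple [CompleteSpace H₁] [CompleteSpace H₂] {ι₁ : Type*}
    [Countable ι₁] (b₁ : HilbertBasis ι₁ ℂ H₁)
    (hF : ∀ k f, F (translate k f) = shift k (F f))
    {A : Circle → H₁ →L[ℂ] H₁} {NA : Submodule ℂ H₁}
    {B C : Circle → H₂ →L[ℂ] H₂} {NB : Submodule ℂ H₂}
    (h : CondRigid A NA B NB C) (hcompat : CondCompat F G A C) :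
    ∃ R : Circle → ClosedSubmodule ℂ H₁,
      IsMeasurableRange R ∧ (∀ᵐ ω ∂circleMeasure, Module.finrank ℂ (R ω) = 1) ∧
      F ⁻¹' rangeSpace R = F ⁻¹' closedSpan (shiftedConstImage A) ∧
      F ⁻¹' rangeSpace R = G ⁻¹' closedSpan (constImage C) ∧
      ∀ ψ : L2R, CondLine F G ψ A B →
        F ⁻¹' rangeSpace R = closedSpan (Set.range fun k : ℤ => translate k ψ) := by
  obtain ⟨x, hx, hx1⟩ := exists_mem_norm_eq_one h.finrank_A
  set a : L2T H₁ := constField b₁ h.rigid_A x with ha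
  have hAa : closedSpan (constImage A) = closedSpan {a} :=
    closedSpan_constImage_eq_singleton b₁ h.rigid_A h.finrank_A hx
      (norm_ne_zero_iff.1 (by rw [hx1]; exact one_ne_zero))
  have hone : ∀ᵐ ω ∂circleMeasure, ‖a ω‖ = 1 := by
    refine ae_norm_eq_one_of_ae_inner ?_
    filter_upwards [ae_inner_constField b₁ h.rigid_A hx hx] with ω hω
    rw [hω, inner_self_eq_norm_sq_to_K, hx1]; simp
  refine ⟨fun ω => ⟨Submodule.span ℂ {a ω}, Submodule.closed_of_finiteDimensional _⟩,
    isMeasurableRange_span_singleton (Lp.stronglyMeasurable a), ?_, ?_⟩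
  · filter_upwards [hone] with ω hω
    exact finrank_span_singleton (norm_ne_zero_iff.1 (by rw [hω]; exact one_ne_zero))
  · rw [rangeSpace_eq_closedSpan_shift (a := a) (.of_forall fun ω => rfl),
      ← closedSpan_shiftedConstImage hAa]
    exact ⟨rfl, hcompat, fun ψ hψ => hψ.preimage_shifted hF⟩

end Wavelet

end WaveletModel

end

open WaveletModel in
theorem theorem3 {I J : Type*} [Countable I] [Countable J]
    (L : HilbertBasis I ℂ (Lp ℂ 2 (volume.restrict (Ico (0 : ℝ) 1))))
    (u : HilbertBasis I ℂ (Seq I))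
    (K : ∀ s : ℤˣ, HilbertBasis J ℂ (Lp ℂ 2 (volume.restrict (cell s))))
    (w : HilbertBasis (ℤˣ × J) ℂ (SeqPair J)) :
    -- every orthonormal wavelet has a triple, and the triple is essentially unique
    (∀ ψ : L2R, IsOrthonormalWavelet ψ →
      (∃ (A : Circle → Seq I →L[ℂ] Seq I) (NA : Submodule ℂ (Seq I))
          (B C : Circle → SeqPair J →L[ℂ] SeqPair J) (NB : Submodule ℂ (SeqPair J)),
        CondRigid A NA B NB C ∧
        CondCompat (transModel L u) (dilModel K w) A C ∧
        CondLine (transModel L u) (dilModel K w) ψ A B) ∧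
      (∀ (A A' : Circle → Seq I →L[ℂ] Seq I) (NA NA' : Submodule ℂ (Seq I))
          (B B' C C' : Circle → SeqPair J →L[ℂ] SeqPair J) (NB NB' : Submodule ℂ (SeqPair J)),
        CondRigid A NA B NB C → CondRigid A' NA' B' NB' C' →
        CondCompat (transModel L u) (dilModel K w) A C →
        CondCompat (transModel L u) (dilModel K w) A' C' →
        CondLine (transModel L u) (dilModel K w) ψ A B →
        CondLine (transModel L u) (dilModel K w) ψ A' B' →
        EqUpToRightFactor A A' ∧ EqUpToRightFactor B B' ∧ EqUpToRightFactor C C')) ∧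
    -- every compatible triple comes from an orthonormal wavelet, and has a range function
    (∀ (A : Circle → Seq I →L[ℂ] Seq I) (NA : Submodule ℂ (Seq I))
        (B C : Circle → SeqPair J →L[ℂ] SeqPair J) (NB : Submodule ℂ (SeqPair J)),
      CondRigid A NA B NB C →
      CondCompat (transModel L u) (dilModel K w) A C →
      transModel L u ⁻¹' closedSpan (constImage A) = dilModel K w ⁻¹' closedSpan (constImage B) →
      (∀ x ∈ NA, ‖x‖ = 1 → ∃ ψ : L2R,
        (∀ φ : L2R, transModel L u φ =ᵐ[circleMeasure] (fun ω => A ω x) ↔ φ = ψ) ∧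
        (∃! y : SeqPair J, y ∈ NB ∧ ‖y‖ = 1 ∧
          ∀ φ : L2R, dilModel K w φ =ᵐ[circleMeasure] (fun ω => B ω y) ↔ φ = ψ) ∧
        IsOrthonormalWavelet ψ ∧
        CondLine (transModel L u) (dilModel K w) ψ A B ∧
        (∀ ψ' : L2R, IsOrthonormalWavelet ψ' →
          CondLine (transModel L u) (dilModel K w) ψ' A B → ∃ c : ℂ, ‖c‖ = 1 ∧ ψ' = c • ψ)) ∧
      (∃ R : Circle → ClosedSubmodule ℂ (Seq I),
        IsMeasurableRange R ∧
        (∀ᵐ ω ∂circleMeasure, Module.finrank ℂ (R ω) = 1) ∧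
        transModel L u ⁻¹' rangeSpace R =
          transModel L u ⁻¹' closedSpan (shiftedConstImage A) ∧
        transModel L u ⁻¹' rangeSpace R = dilModel K w ⁻¹' closedSpan (constImage C) ∧
        ∀ ψ : L2R, CondLine (transModel L u) (dilModel K w) ψ A B →
          transModel L u ⁻¹' rangeSpace R = closedSpan (Set.range fun k : ℤ => translate k ψ))) := by
  obtain ⟨F, hF, hFshift⟩ := exists_transModel_isometryEquiv L u
  obtain ⟨G, hG, hGshift⟩ := exists_dilModel_isometryEquiv K w
  rw [hF, hG]
  refine ⟨fun ψ hψ => ⟨exists_triple w hFshift hGshift hψ, ?_⟩, ?_⟩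
  · intro A A' NA NA' B B' C C' NB NB' h h' hcompat hcompat' hline hline'
    exact eqUpToRightFactor_triple u w hFshift h h' hcompat hcompat' hline hline'
  · intro A NA B C NB h hcompat hline
    exact ⟨fun x hx hx1 => exists_wavelet_of_triple u w hFshift hGshift h hcompat hline hx hx1,
      exists_range_of_triple u hFshift h hcompat⟩
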